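/- Let $\Bbbk$ be a field of characteristic zero, let $a,b,k,p,q\in\Bbbk$ and let $V$ be the vector space with basis $x_1,x_2,x_3$ and braiding $c$ (the braiding of type $\mathfrak R_{1,2}$ with $t=1$) \begin{align*} c(x_i\otimes x_1)&=x_1\otimes x_i,\quad c(x_i\otimes x_2)=x_2\otimes x_i\quad (i=1,2), & c(x_1\otimes x_3)&=(x_3+p\,x_1)\otimes x_1,\\ c(x_3\otimes x_1)&=x_1\otimes x_3+b\,x_1\otimes x_1, & c(x_2\otimes x_3)&=(x_3+q\,x_1)\otimes x_2,\\ c(x_3\otimes x_2)&=x_2\otimes x_3+b\,x_2\otimes x_1+(p-q)\,x_1\otimes x_2,\\ c(x_3\otimes x_3)&=x_3\otimes x_3+b\,x_3\otimes x_1+p\,x_1\otimes x_3+k\,(x_1\otimes x_2-x_2\otimes x_1)+a\,x_1\otimes x_1. \end{align*} Let $T(V)$ be the tensor algebra, a braided Hopf algebra in which the elements of $V$ are primitive, let $\mathcal J(V)$ be its largest homogeneous Hopf ideal generated by homogeneous elements of degree $\ge 2$, and let $\mathfrak B(V)=T(V)/\mathcal J(V)$ be the Nichols algebra of $(V,c)$.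 Define $z_0=x_2$ and, for $n\ge 1$, $$z_n=(x_3-nb\,x_1)z_{n-1}-z_{n-1}x_3+(n-1)!\,(q-p)\Big(\frac{-b-p}{2}\Big)^{n-1}x_1^nx_2 ,\qquad \beta_n=-n\Big(\frac{n+1}{2}\,b+\frac{n-1}{2}\,p+q\Big),$$ with the convention $0^0=1$. Assume that $b\ne p-2q$, and consider the relations $$(1)\ \ x_2x_1-x_1x_2,\quad x_3x_1-x_1x_3+\tfrac{p-b}{2}\,x_1^2;\qquad\qquad (2)\ \ z_{n+1}z_n-z_nz_{n+1}\quad (n\ge 0).$$ (a) If $\beta_n\neq 0$ for all $n\ge 1$, then $\mathcal J(V)$ is the two-sided ideal generated by (1) and (2); the monomials $x_1^{a_1}x_2^{a_2}z_1^{b_1}\cdots z_n^{b_n}x_3^{a_3}$ ($n\ge1$, $a_i,b_j\ge 0$), indexed by $(a_1,a_2,a_3)\in\mathbb N_0^3$ and the finitely supported sequence $(b_j)_{j\ge 1}$ of exponents, form a basis (the PBW-basis $B_\infty$) of $\mathfrak B(V)$; and $\operatorname{GKdim}\mathfrak B(V)=\infty$. (b) Otherwise there is a unique $N\ge 1$ with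 $\beta_N=0$; then $\mathcal J(V)$ is the two-sided ideal generated by (1), (2) and $z_{N+1}+(N+1)\frac{b+p}{2}\,x_1z_N$; the monomials $x_1^{a_1}x_2^{a_2}z_1^{b_1}\cdots z_N^{b_N}x_3^{a_3}$ ($a_i,b_j\ge 0$), indexed by their exponents, form a basis (the PBW-basis $B_{N+3}$) of $\mathfrak B(V)$; and $\operatorname{GKdim}\mathfrak B(V)=N+3$. -/

import Mathlib

open scoped TensorProduct

noncomputable section

namespace Nichols

/-! ### The Nichols algebra of a braiding in coordinates

A braided vector space with basis `(x_i)_{i ∈ ι}` is given by the coefficients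
`c (x_i ⊗ x_j) = ∑ k l, r i j k l • x_k ⊗ x_l`.  The tensor algebra `T(V)` is
`FreeAlgebra K ι`. -/

section General

variable {K : Type*} [Field K] {ι : Type*} [Fintype ι] [DecidableEq ι]

/-- The extension of the braiding to `V ⊗ T(V) → T(V) ⊗ V`, as a matrix of linear forms:
`c (x_i ⊗ y) = ∑ m, (braidGen r y i m) ⊗ x_m`.  The identity
`c (v ⊗ y y') = (id ⊗ c) (c ⊗ id) (v ⊗ y ⊗ y')` says that `y ↦ braidGen r y` is multiplicative. -/
def braidGen (r : ι → ι → Matrix ι ι K) :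
    FreeAlgebra K ι →ₐ[K] Matrix ι ι (FreeAlgebra K ι) :=
  FreeAlgebra.lift K fun j =>
    Matrix.of fun i m => ∑ l, r i j l m • FreeAlgebra.ι K l

/-- Left multiplication by `x_i ⊗ 1 + 1 ⊗ x_i` on `T(V) ⊗ T(V)` with its braided product
`(y ⊗ z)(y' ⊗ z') = y c(z ⊗ y') z'`; that is,
`y ⊗ z ↦ x_i y ⊗ z + ∑ m, (braidGen r y i m) ⊗ x_m z`. -/
def primitiveMul (r : ι → ι → Matrix ι ι K) (i : ι) :
    Module.End K (FreeAlgebra K ι ⊗[K] FreeAlgebra K ι) :=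
  TensorProduct.map (LinearMap.mulLeft K (FreeAlgebra.ι K i)) LinearMap.id +
    ∑ m, TensorProduct.map
      (Matrix.entryLinearMap K (FreeAlgebra K ι) i m ∘ₗ (braidGen r).toLinearMap)
      (LinearMap.mulLeft K (FreeAlgebra.ι K m))

/-- The braided coproduct of `T(V)`: the multiplicative map (for the braided product on
`T(V) ⊗ T(V)`) with `Δ(x_i) = x_i ⊗ 1 + 1 ⊗ x_i`. -/
def coproduct (r : ι → ι → Matrix ι ι K) :
    FreeAlgebra K ι →ₗ[K] FreeAlgebra K ι ⊗[K] FreeAlgebra K ι :=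
  LinearMap.applyₗ (1 ⊗ₜ[K] 1) ∘ₗ (FreeAlgebra.lift K (primitiveMul r)).toLinearMap

variable (K ι) in
/-- The homogeneous component `Tⁿ(V)`. -/
def degreePart (n : ℕ) : Submodule K (FreeAlgebra K ι) :=
  Submodule.span K (Set.range (FreeAlgebra.ι K)) ^ n

/-- `I` is a homogeneous Hopf ideal of `T(V)` generated by homogeneous elements of degree `≥ 2`.
Such an ideal is killed by the counit, and since it is graded with `I⁰ = 0`, the recursion
`S(x) = -x - ∑ S(x') x''` shows that it is automatically stable under the antipode. -/
def IsHopfIdeal (r : ι → ι → Matrix ι ι K) (I : TwoSidedIdeal (FreeAlgebra K ι)) : Prop :=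
  (∃ S : Set (FreeAlgebra K ι),
    (∀ s ∈ S, ∃ n, 2 ≤ n ∧ s ∈ degreePart K ι n) ∧ I = TwoSidedIdeal.span S) ∧
  ∀ x ∈ I, coproduct r x ∈
    Submodule.span K {w | ∃ y z : FreeAlgebra K ι, (y ∈ I ∨ z ∈ I) ∧ w = y ⊗ₜ[K] z}

/-- The ideal `J(V)`: the largest homogeneous Hopf ideal generated in degrees `≥ 2`
(the sum of all of them). -/
def nicholsIdeal (r : ι → ι → Matrix ι ι K) : TwoSidedIdeal (FreeAlgebra K ι) :=
  sSup {I | IsHopfIdeal r I}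

/-- The Nichols algebra `B(V) = T(V) / J(V)`. -/
abbrev NicholsAlgebra (r : ι → ι → Matrix ι ι K) : Type _ :=
  (nicholsIdeal r).ringCon.Quotient

/-- The projection `T(V) → B(V)`. -/
def proj (r : ι → ι → Matrix ι ι K) : FreeAlgebra K ι →ₐ[K] NicholsAlgebra r :=
  (nicholsIdeal r).ringCon.mkₐ (α := K)

end General

/-- The Gelfand-Kirillov dimension of a `K`-algebra: the supremum over the finite-dimensional
subspaces `W` of `limsup (log dim (K + W + ⋯ + Wⁿ) / log n)`. -/
def GKdim (K A : Type*) [Field K] [Ring A] [Algebra K A] : EReal :=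
  ⨆ W : {W : Submodule K A // W.FG},
    Filter.limsup (fun n : ℕ =>
      ((Real.log (Module.finrank K ↥((1 ⊔ W.1) ^ n)) / Real.log n : ℝ) : EReal)) Filter.atTop

/-- The family `f` is a basis of the vector space `M`. -/
def IsBasis (K : Type*) {M σ : Type*} [Field K] [AddCommGroup M] [Module K M] (f : σ → M) : Prop :=
  LinearIndependent K f ∧ Submodule.span K (Set.range f) = ⊤

/-! ### The family `R_{1,2}` -/

section R12

variable {K : Type*} [Field K]

/-- The braiding of type `R_{1,2}`: `R12 t a b p q k i j` is the matrix whose `(m, l)` entry is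
the coefficient of `x_m ⊗ x_l` in `c (x_i ⊗ x_j)`; indices `0, 1, 2` stand for `1, 2, 3`. -/
def R12 (t a b p q k : K) : Fin 3 → Fin 3 → Matrix (Fin 3) (Fin 3) K
  | 0, 0 => !![t, 0, 0; 0, 0, 0; 0, 0, 0]
  | 0, 1 => !![0, 0, 0; t, 0, 0; 0, 0, 0]
  | 0, 2 => !![t * p, 0, 0; 0, 0, 0; t, 0, 0]
  | 1, 0 => !![0, t, 0; 0, 0, 0; 0, 0, 0]
  | 1, 1 => !![0, 0, 0; 0, t, 0; 0, 0, 0]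
  | 1, 2 => !![0, t * q, 0; 0, 0, 0; 0, t, 0]
  | 2, 0 => !![t * b, 0, t; 0, 0, 0; 0, 0, 0]
  | 2, 1 => !![0, t * (p - q), 0; t * b, 0, t; 0, 0, 0]
  | 2, 2 => !![t * a, t * k, t * p; -(t * k), 0, 0; t * b, 0, t]

variable (K) in
/-- The generators `x_1, x_2, x_3` of `T(V)` (indexed by `0, 1, 2`). -/
abbrev x (i : Fin 3) : FreeAlgebra K (Fin 3) := FreeAlgebra.ι K i

/-- The elements `z_n`: `z_0 = x_2` and
`z_n = (x_3 - n b x_1) z_{n-1} - z_{n-1} x_3 + (n-1)! (q-p) ((-b-p)/2)^{n-1} x_1^n x_2`. -/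
def z (b p q : K) : ℕ → FreeAlgebra K (Fin 3)
  | 0 => x K 1
  | n + 1 =>
    (x K 2 - (((n : K) + 1) * b) • x K 0) * z b p q n - z b p q n * x K 2 +
      ((n.factorial : K) * (q - p) * ((-b - p) / 2) ^ n) • (x K 0 ^ (n + 1) * x K 1)

/-- `β_n = -n ((n+1)/2 b + (n-1)/2 p + q)`. -/
def beta (b p q : K) (n : ℕ) : K :=
  -(n : K) * (((n : K) + 1) / 2 * b + ((n : K) - 1) / 2 * p + q)

/-- The two quadratic relations. -/
def quadraticRels (b p : K) : Set (FreeAlgebra K (Fin 3)) :=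
  {x K 1 * x K 0 - x K 0 * x K 1,
   x K 2 * x K 0 - x K 0 * x K 2 + ((p - b) / 2) • x K 0 ^ 2}

/-- The relations `z_{n+1} z_n - z_n z_{n+1}`, `n ≥ 0`. -/
def zRels (b p q : K) : Set (FreeAlgebra K (Fin 3)) :=
  Set.range fun n : ℕ => z b p q (n + 1) * z b p q n - z b p q n * z b p q (n + 1)

/-- The monomial `x_1^{a₁} x_2^{a₂} z_1^{e_1} ⋯ z_n^{e_n} x_3^{a₃}`
(`e_j` is `e (j - 1)` in the code). -/
def monomial (b p q : K) {n : ℕ} (a₁ a₂ : ℕ) (e : Fin n → ℕ) (a₃ : ℕ) : FreeAlgebra K (Fin 3) :=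
  x K 0 ^ a₁ * x K 1 ^ a₂ * (List.ofFn fun j : Fin n => z b p q (j + 1) ^ e j).prod * x K 2 ^ a₃

/-- The family `B_∞`, indexed by its exponents `(a₁, a₂, e, a₃)`, where `e` is finitely supported;
the length `n` of the monomial is taken so that all later exponents vanish. -/
def BInfty (b p q : K) (s : ℕ × ℕ × (ℕ →₀ ℕ) × ℕ) : FreeAlgebra K (Fin 3) :=
  monomial b p q s.1 s.2.1 (fun j : Fin (s.2.2.1.support.sup Nat.succ) => s.2.2.1 j) s.2.2.2

/-- The family `B_{N+3}`, indexed by its exponents `(a₁, a₂, e, a₃)`. -/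
def BFin (b p q : K) (N : ℕ) (s : ℕ × ℕ × (Fin N → ℕ) × ℕ) : FreeAlgebra K (Fin 3) :=
  monomial b p q s.1 s.2.1 s.2.2.1 s.2.2.2

end R12

end Nichols

end

/-!
The Nichols ideal is the set of elements with zero counit that are killed by all iterated skew
derivations `∂_i`, so an element of the Nichols algebra is determined by its counit and its skew
derivatives.

The elements `v_n` given by `v_0 = x_2` and `v_{n+1} = [x_3, v_n] - (n + 1) b x_1 v_n` satisfy
`∂_1 v_n = ∂_3 v_n = 0`, and `∂_2 v_n` is `ρ_n x_1 ^ n` for a scalar `ρ_n` which vanishes if and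
only if one of `β_1, …, β_{n-1}` does. Hence `x_1, v_0, v_1, …` commute, and on polynomials in them
`∂_1` and `∂_2` become a partial derivative and a lowering operator; those `v_n` with `ρ_n ≠ 0` are
therefore algebraically independent together with `x_1`, and `v_n = 0` if `ρ_n = 0`. Since
`∂_3` kills the polynomials and differentiates the powers of `x_3`, these powers are
independent over them. The `z_n` are obtained from the `v_n` by a triangular substitution.

Conversely, the relations make `x_1, z_0, z_1, …` commute and allow one to move `x_3` to the right,
so that the monomials of the PBW-basis span the algebra they define. Counting the monomials of
bounded degree gives the Gelfand–Kirillov dimension.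
-/

noncomputable section

namespace Nichols

theorem lie_lie_comm {A : Type*} [Ring A] {t u v : A} (h : Commute u v) :
    ⁅⁅t, u⁆, v⁆ = ⁅⁅t, v⁆, u⁆ := by
  have jacobi : ⁅⁅t, u⁆, v⁆ = ⁅⁅t, v⁆, u⁆ + (t * (u * v - v * u) - (u * v - v * u) * t) := by
    simp only [Ring.lie_def]
    noncomm_ring
  rw [jacobi, h.eq, sub_self, mul_zero, zero_mul, sub_zero, add_zero]

section Slice

variable {K M N : Type*} [CommRing K] [AddCommGroup M] [Module K M] [AddCommGroup N] [Module K N]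

/-- The slice map `id ⊗ f : M ⊗ N → M` of a linear form `f` on `N`. -/
def slice (f : N →ₗ[K] K) : M ⊗[K] N →ₗ[K] M :=
  (TensorProduct.rid K M).toLinearMap ∘ₗ f.lTensor M

theorem slice_tmul (f : N →ₗ[K] K) (u : M) (v : N) : slice f (u ⊗ₜ[K] v) = f v • u := by
  simp [slice]

theorem ker_map_mkQ_le (U : Submodule K M) (U' : Submodule K N) :
    LinearMap.ker (TensorProduct.map U.mkQ U'.mkQ) ≤
      Submodule.span K {w | ∃ y z, (y ∈ U ∨ z ∈ U') ∧ w = y ⊗ₜ[K] z} := by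
  rw [TensorProduct.map_ker (LinearMap.exact_subtype_mkQ U) U.mkQ_surjective
      (LinearMap.exact_subtype_mkQ U') U'.mkQ_surjective,
    LinearMap.lTensor, LinearMap.rTensor, TensorProduct.range_map_eq_span_tmul,
    TensorProduct.range_map_eq_span_tmul, sup_le_iff]
  constructor <;> refine Submodule.span_mono ?_
  · rintro _ ⟨u, v, rfl⟩
    exact ⟨u, v, Or.inr v.2, rfl⟩
  · rintro _ ⟨u, v, rfl⟩
    exact ⟨u, v, Or.inl u.2, rfl⟩

end Slice

theorem mem_span_tmul_of_slice {K M N κ : Type*} [Field K] [AddCommGroup M] [Module K M]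
    [AddCommGroup N] [Module K N] {U : Submodule K M} {U' : Submodule K N} (f : κ → N →ₗ[K] K)
    (hU' : ∀ y, (∀ j, f j y = 0) → y ∈ U') {w : M ⊗[K] N} (hw : ∀ j, slice (f j) w ∈ U) :
    w ∈ Submodule.span K {w | ∃ y z, (y ∈ U ∨ z ∈ U') ∧ w = y ⊗ₜ[K] z} := by
  classical
  refine ker_map_mkQ_le U U' (LinearMap.mem_ker.2 ?_)
  let B := Module.Basis.ofVectorSpace K (M ⧸ U)
  refine (TensorProduct.equivFinsuppOfBasisLeft B).injective (Finsupp.ext fun i => ?_)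
  let g : M →ₗ[K] K := B.coord i ∘ₗ U.mkQ
  let leftSlice : M ⊗[K] N →ₗ[K] N := (TensorProduct.lid K N).toLinearMap ∘ₗ g.rTensor N
  have coord_eq (w) : TensorProduct.equivFinsuppOfBasisLeft B (TensorProduct.map U.mkQ U'.mkQ w) i =
      U'.mkQ (leftSlice w) := by
    induction w with
    | zero => simp
    | add a b ha hb => simp only [map_add, Finsupp.add_apply, ha, hb]
    | tmul u v => simp [leftSlice, g]
  have slice_comm (j w) : f j (leftSlice w) = g (slice (f j) w) := by
    induction w with
    | zero => simp
    | add a b ha hb => simp only [map_add, ha, hb]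
    | tmul u v => simp [leftSlice, slice_tmul, mul_comm]
  rw [coord_eq, map_zero, Finsupp.zero_apply, Submodule.mkQ_apply, Submodule.Quotient.mk_eq_zero]
  refine hU' _ fun j => ?_
  rw [slice_comm, LinearMap.comp_apply, Submodule.mkQ_apply,
    (Submodule.Quotient.mk_eq_zero U).2 (hw j), map_zero]

theorem sum_sum_comm {ι κ M : Type*} [Fintype ι] [Fintype κ] [AddCommMonoid M]
    (f : ι → ι → κ → κ → M) :
    ∑ i, ∑ j, ∑ k, ∑ l, f i j k l = ∑ k, ∑ l, ∑ i, ∑ j, f i j k l := by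
  rw [Finset.sum_comm_cycle]
  exact Finset.sum_congr rfl fun k _ => Finset.sum_comm_cycle

theorem freeAlgebra_induction_left {R ι : Type*} [CommSemiring R] {P : FreeAlgebra R ι → Prop}
    (one : P 1) (ι_mul : ∀ i y, P y → P (FreeAlgebra.ι R i * y))
    (add : ∀ y z, P y → P z → P (y + z)) (smul : ∀ (c : R) y, P y → P (c • y))
    (y : FreeAlgebra R ι) : P y := by
  suffices ∀ y z : FreeAlgebra R ι, P z → P (y * z) by simpa using this y 1 one
  intro y
  induction y using FreeAlgebra.induction with
  | grade0 c => intro z hz; rw [← Algebra.smul_def]; exact smul _ _ hz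
  | grade1 i => intro z hz; exact ι_mul i z hz
  | mul u v hu hv => intro z hz; rw [mul_assoc]; exact hu _ (hv _ hz)
  | add u v hu hv => intro z hz; rw [add_mul]; exact add _ _ (hu _ hz) (hv _ hz)

section LinearPart

variable {K : Type*} [Field K] {ι : Type*}

/-- The counit of `T(V)`. -/
abbrev counit : FreeAlgebra K ι →ₐ[K] K := FreeAlgebra.algebraMapInv

theorem counit_ι (i : ι) : counit (FreeAlgebra.ι K i) = 0 := by
  simp [counit, FreeAlgebra.algebraMapInv]

variable [DecidableEq ι]

/-- The algebra map `T(V) → K[ε]` with `x_i ↦ δ_{im} ε`. -/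
def linDual (m : ι) : FreeAlgebra K ι →ₐ[K] TrivSqZeroExt K K :=
  FreeAlgebra.lift K fun i => TrivSqZeroExt.inr (if i = m then 1 else 0)

theorem fst_linDual (m : ι) (y : FreeAlgebra K ι) : (linDual m y).fst = counit y := by
  have : (TrivSqZeroExt.fstHom K K K).comp (linDual m) = counit (ι := ι) := by
    ext i; by_cases h : i = m <;> simp [linDual, counit, FreeAlgebra.algebraMapInv, h]
  exact DFunLike.congr_fun this y

/-- The coefficient of `x_m` in an element of `T(V)`. -/
def linCoeff (m : ι) : FreeAlgebra K ι →ₗ[K] K :=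
  (TrivSqZeroExt.sndHom K K).restrictScalars K ∘ₗ (linDual m).toLinearMap

theorem linCoeff_mul (m : ι) (y z : FreeAlgebra K ι) :
    linCoeff m (y * z) = counit y * linCoeff m z + linCoeff m y * counit z := by
  simp [linCoeff, TrivSqZeroExt.snd_mul, fst_linDual, mul_comm]

theorem linCoeff_ι (m i : ι) : linCoeff m (FreeAlgebra.ι K i) = if i = m then 1 else 0 := by
  by_cases h : i = m <;> simp [linCoeff, linDual, h]

theorem linCoeff_one (m : ι) : linCoeff m (1 : FreeAlgebra K ι) = 0 := by
  simp [linCoeff]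

theorem linCoeff_ι_mul (m i : ι) (y : FreeAlgebra K ι) :
    linCoeff m (FreeAlgebra.ι K i * y) = (if i = m then 1 else 0) * counit y := by
  rw [linCoeff_mul, counit_ι, linCoeff_ι, zero_mul, zero_add]

end LinearPart

section SkewDerivations

variable {K : Type*} [Field K] {ι : Type*} [DecidableEq ι] [Fintype ι] (r : ι → ι → Matrix ι ι K)

theorem coproduct_one : coproduct r 1 = 1 ⊗ₜ[K] 1 := by
  simp [coproduct]

theorem coproduct_ι_mul (i : ι) (y : FreeAlgebra K ι) :
    coproduct r (FreeAlgebra.ι K i * y) = primitiveMul r i (coproduct r y) := by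
  simp [coproduct]

theorem primitiveMul_tmul (i : ι) (u v : FreeAlgebra K ι) :
    primitiveMul r i (u ⊗ₜ[K] v) =
      (FreeAlgebra.ι K i * u) ⊗ₜ[K] v + ∑ m, braidGen r u i m ⊗ₜ[K] (FreeAlgebra.ι K m * v) := by
  simp [primitiveMul]

theorem braidGen_one_apply (i m : ι) :
    braidGen r (1 : FreeAlgebra K ι) i m = if i = m then 1 else 0 := by
  rw [map_one, Matrix.one_apply]

theorem braidGen_mul_apply (y z : FreeAlgebra K ι) (i m : ι) :
    braidGen r (y * z) i m = ∑ s, braidGen r y i s * braidGen r z s m := by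
  rw [map_mul, Matrix.mul_apply]

theorem braidGen_ι (j i m : ι) :
    braidGen r (FreeAlgebra.ι K j) i m = ∑ l, r i j l m • FreeAlgebra.ι K l := by
  simp [braidGen]

theorem braidGen_ι_mul (j : ι) (y : FreeAlgebra K ι) (i m : ι) :
    braidGen r (FreeAlgebra.ι K j * y) i m =
      ∑ l, ∑ s, r i j l s • (FreeAlgebra.ι K l * braidGen r y s m) := by
  simp only [braidGen_mul_apply, braidGen_ι, Finset.sum_mul, smul_mul_assoc]
  exact Finset.sum_comm

theorem counit_braidGen (y : FreeAlgebra K ι) (i m : ι) :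
    counit (braidGen r y i m) = if i = m then counit y else 0 := by
  induction y using freeAlgebra_induction_left with
  | one => rw [braidGen_one_apply]; split_ifs <;> simp
  | ι_mul j y => simp [braidGen_ι_mul, counit_ι]
  | add y z hy hz => simp only [map_add, Matrix.add_apply, hy, hz]; split_ifs <;> simp
  | smul c y hy => simp only [map_smul, Matrix.smul_apply, hy]; split_ifs <;> simp

theorem slice_counit_primitiveMul (i : ι) (w : FreeAlgebra K ι ⊗[K] FreeAlgebra K ι) :
    slice counit.toLinearMap (primitiveMul r i w) =
      FreeAlgebra.ι K i * slice counit.toLinearMap w := by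
  induction w with
  | zero => simp
  | add a b ha hb => simp only [map_add, ha, hb, mul_add]
  | tmul u v => simp [primitiveMul_tmul, slice_tmul, counit_ι]

theorem slice_counit_coproduct (y : FreeAlgebra K ι) :
    slice counit.toLinearMap (coproduct r y) = y := by
  induction y using freeAlgebra_induction_left with
  | one => simp [coproduct_one, slice_tmul]
  | ι_mul i y ih => rw [coproduct_ι_mul, slice_counit_primitiveMul, ih]
  | add y z hy hz => rw [map_add, map_add, hy, hz]
  | smul c y hy => rw [map_smul, map_smul, hy]

/-- The skew derivation `∂_m` of `T(V)`, the component of the coproduct in `T(V) ⊗ x_m`. -/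
def skewDer (m : ι) : FreeAlgebra K ι →ₗ[K] FreeAlgebra K ι :=
  slice (linCoeff m) ∘ₗ coproduct r

theorem skewDer_one (m : ι) : skewDer r m 1 = 0 := by
  simp [skewDer, coproduct_one, slice_tmul, linCoeff_one]

theorem slice_linCoeff_primitiveMul (m i : ι) (w : FreeAlgebra K ι ⊗[K] FreeAlgebra K ι) :
    slice (linCoeff m) (primitiveMul r i w) =
      FreeAlgebra.ι K i * slice (linCoeff m) w +
        braidGen r (slice counit.toLinearMap w) i m := by
  induction w with
  | zero => simp
  | add a b ha hb => simp only [map_add, ha, hb, mul_add, Matrix.add_apply]; abel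
  | tmul u v => simp [primitiveMul_tmul, slice_tmul, linCoeff_ι_mul]

theorem skewDer_ι_mul (m i : ι) (y : FreeAlgebra K ι) :
    skewDer r m (FreeAlgebra.ι K i * y) =
      FreeAlgebra.ι K i * skewDer r m y + braidGen r y i m := by
  simp only [skewDer, LinearMap.comp_apply, coproduct_ι_mul, slice_linCoeff_primitiveMul,
    slice_counit_coproduct]

theorem skewDer_ι (m i : ι) : skewDer r m (FreeAlgebra.ι K i) = if i = m then 1 else 0 := by
  rw [← mul_one (FreeAlgebra.ι K i), skewDer_ι_mul, skewDer_one, mul_zero, zero_add,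
    braidGen_one_apply]

theorem skewDer_mul (m : ι) (y z : FreeAlgebra K ι) :
    skewDer r m (y * z) = y * skewDer r m z + ∑ i, skewDer r i y * braidGen r z i m := by
  induction y using freeAlgebra_induction_left generalizing m with
  | one => simp [skewDer_one]
  | ι_mul j y ih =>
    simp only [mul_assoc, skewDer_ι_mul, ih, braidGen_mul_apply, mul_add, add_mul, Finset.mul_sum,
      Finset.sum_add_distrib, add_assoc]
  | add y z hy hz => simp only [add_mul, map_add, hy, hz, Finset.sum_add_distrib]; abel
  | smul c y hy => simp only [smul_mul_assoc, map_smul, hy, smul_add, Finset.smul_sum]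

end SkewDerivations

section Braiding

variable {K : Type*} [Field K] {ι : Type*} [Fintype ι] (r : ι → ι → Matrix ι ι K)

/-- The braid equation `(c ⊗ id)(id ⊗ c)(c ⊗ id) = (id ⊗ c)(c ⊗ id)(id ⊗ c)`, read off at the
coefficient of `x_l ⊗ x_m ⊗ x_n` in the image of `x_a ⊗ x_b ⊗ x_j`. -/
def IsBraiding : Prop :=
  ∀ a b j l m n : ι,
    ∑ i, ∑ i', ∑ s, r a b i i' * (r i' j s n * r i s l m) =
      ∑ i, ∑ i', ∑ s, r i i' m n * (r b j s i' * r a s l i)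

variable [DecidableEq ι]

/-- The extension of the braiding to `(V ⊗ V) ⊗ T(V)`, as an algebra map into matrices. The index
`(b, a)` stands for `x_a ⊗ x_b`. -/
def braidGen₂ : FreeAlgebra K ι →ₐ[K] Matrix (ι × ι) (ι × ι) (FreeAlgebra K ι) :=
  ((Matrix.compAlgEquiv ι ι (FreeAlgebra K ι) K).toAlgHom.comp
    (braidGen r).mapMatrix).comp (braidGen r)

theorem braidGen₂_apply (y : FreeAlgebra K ι) (b a n m : ι) :
    braidGen₂ r y (b, a) (n, m) = braidGen r (braidGen r y b n) a m := by
  simp [braidGen₂, Matrix.compAlgEquiv]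

theorem braidGen_braidGen_ι (j a b m n : ι) :
    braidGen r (braidGen r (FreeAlgebra.ι K j) b n) a m =
      ∑ l, (∑ s, r b j s n * r a s l m) • FreeAlgebra.ι K l := by
  simp only [braidGen_ι, map_sum, map_smul, Matrix.sum_apply, Matrix.smul_apply, Finset.smul_sum,
    smul_smul, Finset.sum_smul]
  exact Finset.sum_comm

/-- The braiding of `V ⊗ V`, in the index convention of `braidGen₂`. -/
def braidMatrix : Matrix (ι × ι) (ι × ι) (FreeAlgebra K ι) :=
  Matrix.of fun s t => algebraMap K _ (r s.2 s.1 t.2 t.1)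

theorem braidMatrix_mul_braidGen₂_apply (y : FreeAlgebra K ι) (a b m n : ι) :
    (braidMatrix r * braidGen₂ r y) (b, a) (n, m) =
      ∑ i, ∑ i', r a b i i' • braidGen r (braidGen r y i' n) i m := by
  rw [Matrix.mul_apply, Fintype.sum_prod_type_right]
  simp only [braidMatrix, Matrix.of_apply, braidGen₂_apply, Algebra.smul_def]

theorem braidGen₂_mul_braidMatrix_apply (y : FreeAlgebra K ι) (a b m n : ι) :
    (braidGen₂ r y * braidMatrix r) (b, a) (n, m) =
      ∑ i, ∑ i', r i i' m n • braidGen r (braidGen r y b i') a i := by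
  rw [Matrix.mul_apply, Fintype.sum_prod_type_right]
  simp only [braidMatrix, Matrix.of_apply, braidGen₂_apply, ← Algebra.commutes, Algebra.smul_def]

variable {r}

theorem IsBraiding.natural_ι (h : IsBraiding r) (j a b m n : ι) :
    ∑ i, ∑ i', r a b i i' • braidGen r (braidGen r (FreeAlgebra.ι K j) i' n) i m =
      ∑ i, ∑ i', r i i' m n • braidGen r (braidGen r (FreeAlgebra.ι K j) b i') a i := by
  simp only [braidGen_braidGen_ι, Finset.smul_sum, smul_smul]
  rw [Finset.sum_comm_cycle, Finset.sum_comm_cycle (f := fun i i' l => (r i i' m n * _) • _)]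
  simp only [← Finset.sum_smul, Finset.mul_sum, h a b j _ m n]

theorem IsBraiding.commute_braidMatrix (h : IsBraiding r) (y : FreeAlgebra K ι) :
    Commute (braidMatrix r) (braidGen₂ r y) := by
  induction y using FreeAlgebra.induction with
  | grade0 c => rw [AlgHom.commutes]; exact (Algebra.commutes c _).symm
  | grade1 j =>
    ext ⟨b, a⟩ ⟨n, m⟩
    rw [braidMatrix_mul_braidGen₂_apply, braidGen₂_mul_braidMatrix_apply, h.natural_ι]
  | mul u v hu hv => rw [map_mul]; exact hu.mul_right hv
  | add u v hu hv => rw [map_add]; exact hu.add_right hv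

theorem IsBraiding.natural (h : IsBraiding r) (y : FreeAlgebra K ι) (a b m n : ι) :
    ∑ i, ∑ i', r a b i i' • braidGen r (braidGen r y i' n) i m =
      ∑ i, ∑ i', r i i' m n • braidGen r (braidGen r y b i') a i := by
  rw [← braidMatrix_mul_braidGen₂_apply, ← braidGen₂_mul_braidMatrix_apply,
    (h.commute_braidMatrix y).eq]

theorem IsBraiding.skewDer_braidGen (h : IsBraiding r) (y : FreeAlgebra K ι) (k i m : ι) :
    skewDer r k (braidGen r y i m) =
      ∑ s, ∑ j, r s j k m • braidGen r (skewDer r j y) i s := by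
  induction y using freeAlgebra_induction_left generalizing k i m with
  | one => rw [braidGen_one_apply]; split_ifs <;> simp [skewDer_one]
  | ι_mul a y ih =>
    simp only [braidGen_ι_mul, map_sum, map_smul, skewDer_ι_mul, ih, smul_add,
      Finset.sum_add_distrib, map_add, Matrix.add_apply, h.natural]
    congr 1
    simp only [Finset.smul_sum, Finset.mul_sum, mul_smul_comm, smul_comm (r i a _ _)]
    exact sum_sum_comm _
  | add y z hy hz =>
    simp only [map_add, Matrix.add_apply, hy, hz, smul_add, Finset.sum_add_distrib]
  | smul c y hy =>
    simp only [map_smul, Matrix.smul_apply, hy, Finset.smul_sum, smul_comm c]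

variable (r) in
/-- The extension of the braiding to `V ⊗ (T(V) ⊗ T(V)) → (T(V) ⊗ T(V)) ⊗ V`, as a matrix of
operators on `T(V) ⊗ T(V)`. -/
def braidTensor (i m : ι) : Module.End K (FreeAlgebra K ι ⊗[K] FreeAlgebra K ι) :=
  ∑ s, TensorProduct.map
    (Matrix.entryLinearMap K (FreeAlgebra K ι) i s ∘ₗ (braidGen r).toLinearMap)
    (Matrix.entryLinearMap K (FreeAlgebra K ι) s m ∘ₗ (braidGen r).toLinearMap)

variable (r) in
theorem braidTensor_tmul (i m : ι) (u v : FreeAlgebra K ι) :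
    braidTensor r i m (u ⊗ₜ[K] v) = ∑ s, braidGen r u i s ⊗ₜ[K] braidGen r v s m := by
  simp [braidTensor]

theorem IsBraiding.braidTensor_primitiveMul (h : IsBraiding r) (i j m : ι)
    (w : FreeAlgebra K ι ⊗[K] FreeAlgebra K ι) :
    braidTensor r i m (primitiveMul r j w) =
      ∑ l, ∑ t, r i j l t • primitiveMul r l (braidTensor r t m w) := by
  induction w with
  | zero => simp
  | add a b ha hb => simp only [map_add, smul_add, Finset.sum_add_distrib, ha, hb]
  | tmul u v =>
    simp only [primitiveMul_tmul, braidTensor_tmul, map_add, map_sum, smul_add,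
      Finset.sum_add_distrib, braidGen_ι_mul]
    congr 1
    · simp only [TensorProduct.sum_tmul, TensorProduct.smul_tmul', Finset.smul_sum]
      exact Finset.sum_comm_cycle.symm
    · have natural_tmul (s n) : ∑ l, ∑ t, r i j l t •
            (braidGen r (braidGen r u t s) l n ⊗ₜ[K] (FreeAlgebra.ι K n * braidGen r v s m)) =
          ∑ l, ∑ t, r l t n s •
            (braidGen r (braidGen r u j t) i l ⊗ₜ[K] (FreeAlgebra.ι K n * braidGen r v s m)) := by
        simp only [TensorProduct.smul_tmul', ← TensorProduct.sum_tmul, h.natural]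
      simp only [TensorProduct.tmul_sum, TensorProduct.tmul_smul, Finset.smul_sum]
      rw [sum_sum_comm, sum_sum_comm fun l t _ _ => r i j l t • _, Finset.sum_comm]
      refine Finset.sum_congr rfl fun s _ => Finset.sum_congr rfl fun n _ => ?_
      rw [natural_tmul, Finset.sum_comm]

end Braiding

section Radical

variable {K : Type*} [Field K] {ι : Type*} [Fintype ι] [DecidableEq ι]
  {r : ι → ι → Matrix ι ι K}

theorem IsBraiding.coproduct_braidGen (h : IsBraiding r) (y : FreeAlgebra K ι) (i m : ι) :
    coproduct r (braidGen r y i m) = braidTensor r i m (coproduct r y) := by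
  induction y using freeAlgebra_induction_left generalizing i m with
  | one =>
    rw [coproduct_one, braidTensor_tmul, Finset.sum_eq_single i (fun s _ hs => ?_) (by simp)]
    · simp only [braidGen_one_apply, if_true]
      split_ifs
      · exact coproduct_one r
      · rw [map_zero, TensorProduct.tmul_zero]
    · rw [braidGen_one_apply, if_neg hs.symm, TensorProduct.zero_tmul]
  | ι_mul j y ih =>
    simp only [braidGen_ι_mul, map_sum, map_smul, coproduct_ι_mul, ih, h.braidTensor_primitiveMul]
  | add y z hy hz => simp only [map_add, Matrix.add_apply, hy, hz]
  | smul c y hy => simp only [map_smul, Matrix.smul_apply, hy]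

theorem lTensor_skewDer_primitiveMul (m i : ι) (w : FreeAlgebra K ι ⊗[K] FreeAlgebra K ι) :
    (skewDer r m).lTensor _ (primitiveMul r i w) =
      primitiveMul r i ((skewDer r m).lTensor _ w) + braidTensor r i m w := by
  induction w with
  | zero => simp
  | add a b ha hb => simp only [map_add, ha, hb]; abel
  | tmul u v =>
    simp only [LinearMap.lTensor_tmul, primitiveMul_tmul, map_add, map_sum, skewDer_ι_mul,
      TensorProduct.tmul_add, Finset.sum_add_distrib, braidTensor_tmul, add_assoc]

-- Coassociativity, restricted to the component in `T(V) ⊗ T(V) ⊗ x_m`.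
theorem IsBraiding.lTensor_skewDer_coproduct (h : IsBraiding r) (m : ι) (y : FreeAlgebra K ι) :
    (skewDer r m).lTensor _ (coproduct r y) = coproduct r (skewDer r m y) := by
  induction y using freeAlgebra_induction_left with
  | one => simp [coproduct_one, skewDer_one]
  | ι_mul i y ih =>
    rw [coproduct_ι_mul, lTensor_skewDer_primitiveMul, ih, skewDer_ι_mul, map_add,
      coproduct_ι_mul, h.coproduct_braidGen]
  | add y z hy hz => simp only [map_add, hy, hz]
  | smul c y hy => simp only [map_smul, hy]

variable (r) in
/-- The iterated skew derivation along a word, the first letter acting first. -/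
def wordDer : List ι → FreeAlgebra K ι →ₗ[K] FreeAlgebra K ι
  | [] => LinearMap.id
  | m :: w => wordDer w ∘ₗ skewDer r m

theorem IsBraiding.slice_wordDer_coproduct (h : IsBraiding r) (w : List ι) (y : FreeAlgebra K ι) :
    slice (counit.toLinearMap ∘ₗ wordDer r w) (coproduct r y) = wordDer r w y := by
  induction w generalizing y with
  | nil => exact slice_counit_coproduct r y
  | cons m w ih =>
    rw [wordDer, LinearMap.comp_apply, ← ih, ← h.lTensor_skewDer_coproduct, slice, slice,
      ← LinearMap.comp_assoc, LinearMap.lTensor_comp]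
    rfl

variable (r) in
/-- The elements of `T(V)` all of whose iterated skew derivatives have vanishing counit. -/
def radicalSubmodule : Submodule K (FreeAlgebra K ι) :=
  ⨅ w, LinearMap.ker (counit.toLinearMap ∘ₗ wordDer r w)

theorem mem_radicalSubmodule {y : FreeAlgebra K ι} :
    y ∈ radicalSubmodule r ↔ ∀ w, counit (wordDer r w y) = 0 := by
  simp [radicalSubmodule]

theorem counit_eq_zero_of_mem_radicalSubmodule {y : FreeAlgebra K ι}
    (hy : y ∈ radicalSubmodule r) : counit y = 0 :=
  mem_radicalSubmodule.1 hy []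

theorem skewDer_mem_radicalSubmodule {y : FreeAlgebra K ι} (hy : y ∈ radicalSubmodule r) (m : ι) :
    skewDer r m y ∈ radicalSubmodule r :=
  mem_radicalSubmodule.2 fun w => mem_radicalSubmodule.1 hy (m :: w)

theorem wordDer_mem_radicalSubmodule {y : FreeAlgebra K ι} (hy : y ∈ radicalSubmodule r)
    (w : List ι) : wordDer r w y ∈ radicalSubmodule r := by
  induction w generalizing y with
  | nil => exact hy
  | cons m _ ih => exact ih (skewDer_mem_radicalSubmodule hy m)

theorem le_radicalSubmodule {S : Submodule K (FreeAlgebra K ι)}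
    (counit_eq : S ≤ LinearMap.ker counit.toLinearMap)
    (skewDer_mem : ∀ m, S ≤ S.comap (skewDer r m)) : S ≤ radicalSubmodule r := by
  intro y hy
  rw [mem_radicalSubmodule]
  intro w
  induction w generalizing y with
  | nil => exact counit_eq hy
  | cons m _ ih => exact ih (skewDer_mem m hy)

theorem mem_radicalSubmodule_iff {y : FreeAlgebra K ι} :
    y ∈ radicalSubmodule r ↔ counit y = 0 ∧ ∀ m, skewDer r m y ∈ radicalSubmodule r := by
  refine ⟨fun hy => ⟨counit_eq_zero_of_mem_radicalSubmodule hy, skewDer_mem_radicalSubmodule hy⟩,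
    fun hy => mem_radicalSubmodule.2 fun w => ?_⟩
  cases w with
  | nil => exact hy.1
  | cons m w => exact mem_radicalSubmodule.1 (hy.2 m) w

theorem IsBraiding.braidGen_mem_radicalSubmodule (h : IsBraiding r) {y : FreeAlgebra K ι}
    (hy : y ∈ radicalSubmodule r) (i m : ι) : braidGen r y i m ∈ radicalSubmodule r := by
  let S : Submodule K (FreeAlgebra K ι) :=
    Submodule.span K {u | ∃ y ∈ radicalSubmodule r, ∃ i m, u = braidGen r y i m}
  suffices S ≤ radicalSubmodule r from this (Submodule.subset_span ⟨y, hy, i, m, rfl⟩)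
  refine le_radicalSubmodule (Submodule.span_le.2 ?_) fun k => Submodule.span_le.2 ?_
  · rintro _ ⟨y, hy, i, m, rfl⟩
    simp [counit_braidGen, counit_eq_zero_of_mem_radicalSubmodule hy]
  · rintro _ ⟨y, hy, i, m, rfl⟩
    rw [SetLike.mem_coe, Submodule.mem_comap, h.skewDer_braidGen]
    exact Submodule.sum_mem _ fun s _ => Submodule.sum_mem _ fun j _ => Submodule.smul_mem _ _
      (Submodule.subset_span ⟨_, skewDer_mem_radicalSubmodule hy j, i, s, rfl⟩)

theorem mul_mem_radicalSubmodule_of_left {y : FreeAlgebra K ι} (hy : y ∈ radicalSubmodule r)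
    (z : FreeAlgebra K ι) : y * z ∈ radicalSubmodule r := by
  suffices radicalSubmodule r * ⊤ ≤ radicalSubmodule r from
    this (Submodule.mul_mem_mul hy Submodule.mem_top)
  refine le_radicalSubmodule (Submodule.mul_le.2 fun y hy z _ => ?_) fun m =>
    Submodule.mul_le.2 fun y hy z _ => ?_
  · simp [counit_eq_zero_of_mem_radicalSubmodule hy]
  · rw [Submodule.mem_comap, skewDer_mul]
    exact add_mem (Submodule.mul_mem_mul hy Submodule.mem_top) (Submodule.sum_mem _ fun i _ =>
      Submodule.mul_mem_mul (skewDer_mem_radicalSubmodule hy i) Submodule.mem_top)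

theorem IsBraiding.mul_mem_radicalSubmodule_of_right (h : IsBraiding r) (y : FreeAlgebra K ι)
    {z : FreeAlgebra K ι} (hz : z ∈ radicalSubmodule r) : y * z ∈ radicalSubmodule r := by
  suffices ⊤ * radicalSubmodule r ≤ radicalSubmodule r from
    this (Submodule.mul_mem_mul Submodule.mem_top hz)
  refine le_radicalSubmodule (Submodule.mul_le.2 fun y _ z hz => ?_) fun m =>
    Submodule.mul_le.2 fun y _ z hz => ?_
  · simp [counit_eq_zero_of_mem_radicalSubmodule hz]
  · rw [Submodule.mem_comap, skewDer_mul]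
    exact add_mem (Submodule.mul_mem_mul Submodule.mem_top (skewDer_mem_radicalSubmodule hz m))
      (Submodule.sum_mem _ fun i _ => Submodule.mul_mem_mul Submodule.mem_top
        (h.braidGen_mem_radicalSubmodule hz i m))

/-- `radicalSubmodule r` as a two-sided ideal; it will turn out to be the Nichols ideal. -/
def IsBraiding.radical (h : IsBraiding r) : TwoSidedIdeal (FreeAlgebra K ι) :=
  TwoSidedIdeal.mk' (radicalSubmodule r) (zero_mem _) add_mem neg_mem
    (h.mul_mem_radicalSubmodule_of_right _) (mul_mem_radicalSubmodule_of_left · _)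

theorem IsBraiding.mem_radical (h : IsBraiding r) {y : FreeAlgebra K ι} :
    y ∈ h.radical ↔ y ∈ radicalSubmodule r := by
  simp [IsBraiding.radical]

theorem IsBraiding.coproduct_mem_of_mem_radicalSubmodule (h : IsBraiding r) {y : FreeAlgebra K ι}
    (hy : y ∈ radicalSubmodule r) : coproduct r y ∈ Submodule.span K
      {w | ∃ u v, (u ∈ radicalSubmodule r ∨ v ∈ radicalSubmodule r) ∧ w = u ⊗ₜ[K] v} := by
  refine mem_span_tmul_of_slice (fun w => counit.toLinearMap ∘ₗ wordDer r w)
    (fun y hy => mem_radicalSubmodule.2 hy) fun w => ?_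
  rw [h.slice_wordDer_coproduct]
  exact wordDer_mem_radicalSubmodule hy w

end Radical

section Grading

variable {K : Type*} [Field K] {ι : Type*}

theorem ι_mem_degreePart_one (i : ι) : FreeAlgebra.ι K i ∈ degreePart K ι 1 := by
  rw [degreePart, pow_one]
  exact Submodule.subset_span ⟨i, rfl⟩

instance : SetLike.GradedMonoid (degreePart K ι) :=
  inferInstanceAs (SetLike.GradedMonoid (Submodule.span K (Set.range (FreeAlgebra.ι K)) ^ ·))

instance : GradedAlgebra (degreePart K ι) := by
  let f : FreeAlgebra K ι →ₐ[K] DirectSum ℕ fun n => degreePart K ι n :=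
    FreeAlgebra.lift K fun i => DirectSum.of _ 1 ⟨FreeAlgebra.ι K i, ι_mem_degreePart_one i⟩
  have f_of_mem {n : ℕ} {y : FreeAlgebra K ι} (hy : y ∈ degreePart K ι n) :
      f y = DirectSum.of (fun n => degreePart K ι n) n ⟨y, hy⟩ := by
    induction hy using Submodule.pow_induction_on_left' with
    | algebraMap c => rw [AlgHom.commutes, DirectSum.algebraMap_apply]; rfl
    | add u v n hu hv hfu hfv => rw [map_add, hfu, hfv, ← map_add]; rfl
    | mem_mul m hm n u hu hfu =>
      have f_lin : f m = DirectSum.of (fun n => degreePart K ι n) 1 ⟨m, by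
          rwa [degreePart, pow_one]⟩ := by
        induction hm using Submodule.span_induction with
        | mem _ hm => obtain ⟨i, rfl⟩ := hm; exact FreeAlgebra.lift_ι_apply _ _
        | zero => rw [map_zero]; exact (map_zero _).symm
        | add u v _ _ hu hv => rw [map_add, hu, hv, ← map_add]; rfl
        | smul c u _ hu => rw [map_smul, hu, ← DirectSum.lof_eq_of K, ← map_smul]; rfl
      rw [map_mul, hfu, f_lin, DirectSum.of_mul_of]
      exact DirectSum.of_eq_of_gradedMonoid_eq (Sigma.subtype_ext (add_comm _ _) rfl)
  refine GradedAlgebra.ofAlgHom _ f ?_ fun n y => f_of_mem y.2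
  ext i
  simp [f]

/-- The homogeneous component of degree `n` of an element of `T(V)`. -/
abbrev component (n : ℕ) : FreeAlgebra K ι →ₗ[K] FreeAlgebra K ι :=
  GradedAlgebra.proj (degreePart K ι) n

theorem mem_of_component_mem {S : Submodule K (FreeAlgebra K ι)} {y : FreeAlgebra K ι}
    (h : ∀ n, component n y ∈ S) : y ∈ S := by
  classical
  rw [← DirectSum.sum_support_decompose (degreePart K ι) y]
  exact Submodule.sum_mem _ fun n _ => h n

theorem component_one (n : ℕ) : component n (1 : FreeAlgebra K ι) = if n = 0 then 1 else 0 := by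
  rw [GradedAlgebra.proj_apply, DirectSum.decompose_one, DirectSum.one_def, DirectSum.coe_of_apply]
  split_ifs <;> simp_all

theorem component_zero_ι_mul (i : ι) (y : FreeAlgebra K ι) :
    component 0 (FreeAlgebra.ι K i * y) = 0 :=
  DirectSum.coe_decompose_mul_of_left_mem_of_not_le _ (ι_mem_degreePart_one i) (by simp)

theorem component_succ_ι_mul (n : ℕ) (i : ι) (y : FreeAlgebra K ι) :
    component (n + 1) (FreeAlgebra.ι K i * y) = FreeAlgebra.ι K i * component n y :=
  DirectSum.coe_decompose_mul_of_left_mem_of_le _ (ι_mem_degreePart_one i) (Nat.le_add_left 1 n)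

theorem component_zero (y : FreeAlgebra K ι) : component 0 y = algebraMap K _ (counit y) := by
  induction y using freeAlgebra_induction_left with
  | one => rw [component_one, if_pos rfl, map_one, map_one]
  | ι_mul i y => rw [component_zero_ι_mul, map_mul, counit_ι, zero_mul, map_zero]
  | add y z hy hz => simp only [map_add, hy, hz]
  | smul c y hy => rw [map_smul, map_smul, hy, smul_eq_mul, map_mul, Algebra.smul_def]

theorem degreePart_succ_le_ker_counit (n : ℕ) :
    degreePart K ι (n + 1) ≤ LinearMap.ker counit.toLinearMap := by
  rw [degreePart, pow_succ, Submodule.mul_le]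
  intro u _ v hv
  have counit_v : counit v = 0 := by
    refine (Submodule.span_le.2 ?_ : _ ≤ LinearMap.ker counit.toLinearMap) hv
    rintro _ ⟨i, rfl⟩
    exact counit_ι i
  simp [counit_v]

theorem counit_component_succ (n : ℕ) (y : FreeAlgebra K ι) : counit (component (n + 1) y) = 0 :=
  degreePart_succ_le_ker_counit n (SetLike.coe_mem _)

theorem degreePart_add_two_le_ker_linCoeff [DecidableEq ι] (n : ℕ) (m : ι) :
    degreePart K ι (n + 2) ≤ LinearMap.ker (linCoeff m) := by
  rw [degreePart, pow_succ, Submodule.mul_le]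
  intro u hu v hv
  rw [← pow_one (Submodule.span K _)] at hv
  have hu : counit u = 0 := degreePart_succ_le_ker_counit n hu
  have hv : counit v = 0 := degreePart_succ_le_ker_counit 0 hv
  rw [LinearMap.mem_ker, linCoeff_mul, hu, hv, zero_mul, mul_zero, add_zero]

end Grading

section NicholsIdeal

variable {K : Type*} [Field K] {ι : Type*} [Fintype ι] [DecidableEq ι]
  {r : ι → ι → Matrix ι ι K}

theorem component_braidGen (n : ℕ) (y : FreeAlgebra K ι) (i m : ι) :
    component n (braidGen r y i m) = braidGen r (component n y) i m := by
  induction y using freeAlgebra_induction_left generalizing n i m with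
  | one =>
    rw [braidGen_one_apply, component_one]
    split_ifs with him hn hn <;> simp [component_one, him, hn, -GradedAlgebra.proj_apply]
  | ι_mul j y ih =>
    cases n with
    | zero => simp only [braidGen_ι_mul, map_sum, map_smul, component_zero_ι_mul, smul_zero,
        Finset.sum_const_zero, map_zero, Matrix.zero_apply]
    | succ n => simp only [braidGen_ι_mul, map_sum, map_smul, component_succ_ι_mul, ih]
  | add y z hy hz => simp only [map_add, Matrix.add_apply, hy, hz]
  | smul c y hy => simp only [map_smul, Matrix.smul_apply, hy]

theorem skewDer_component_zero (m : ι) (y : FreeAlgebra K ι) :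
    skewDer r m (component 0 y) = 0 := by
  rw [component_zero, Algebra.algebraMap_eq_smul_one, map_smul, skewDer_one, smul_zero]

theorem skewDer_component_succ (n : ℕ) (m : ι) (y : FreeAlgebra K ι) :
    skewDer r m (component (n + 1) y) = component n (skewDer r m y) := by
  induction y using freeAlgebra_induction_left generalizing n with
  | one => rw [component_one, if_neg n.succ_ne_zero, skewDer_one, map_zero, map_zero]
  | ι_mul i y ih =>
    rw [component_succ_ι_mul, skewDer_ι_mul, skewDer_ι_mul, map_add, component_braidGen]
    cases n with
    | zero => rw [skewDer_component_zero, mul_zero, component_zero_ι_mul]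
    | succ n => rw [ih, component_succ_ι_mul]
  | add y z hy hz => simp only [map_add, hy, hz]
  | smul c y hy => simp only [map_smul, hy]

theorem component_mem_radicalSubmodule {y : FreeAlgebra K ι} (hy : y ∈ radicalSubmodule r)
    (n : ℕ) : component n y ∈ radicalSubmodule r := by
  induction n generalizing y with
  | zero =>
    rw [component_zero, counit_eq_zero_of_mem_radicalSubmodule hy, map_zero]
    exact zero_mem _
  | succ n ih =>
    refine mem_radicalSubmodule_iff.2 ⟨counit_component_succ n y, fun m => ?_⟩
    rw [skewDer_component_succ]
    exact ih (skewDer_mem_radicalSubmodule hy m)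

theorem eq_zero_of_mem_radicalSubmodule_of_mem_degreePart_one {y : FreeAlgebra K ι}
    (hy : y ∈ radicalSubmodule r) (hlin : y ∈ degreePart K ι 1) : y = 0 := by
  rw [degreePart, pow_one, Submodule.mem_span_range_iff_exists_fun] at hlin
  obtain ⟨c, rfl⟩ := hlin
  refine Finset.sum_eq_zero fun m _ => ?_
  have hm := counit_eq_zero_of_mem_radicalSubmodule (skewDer_mem_radicalSubmodule hy m)
  simp only [map_sum, map_smul, skewDer_ι, apply_ite counit, map_one, map_zero, smul_eq_mul,
    mul_ite, mul_one, mul_zero, Finset.sum_ite_eq', Finset.mem_univ, if_true] at hm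
  rw [hm, zero_smul]

theorem IsBraiding.radical_eq_span (h : IsBraiding r) :
    h.radical = TwoSidedIdeal.span
      {s | s ∈ radicalSubmodule r ∧ ∃ n, 2 ≤ n ∧ s ∈ degreePart K ι n} := by
  refine le_antisymm (fun y hy => ?_) (TwoSidedIdeal.span_le.2 fun s hs => h.mem_radical.2 hs.1)
  rw [h.mem_radical] at hy
  rw [← TwoSidedIdeal.mem_asIdeal, ← Submodule.restrictScalars_mem K]
  refine mem_of_component_mem fun n => ?_
  have hn := component_mem_radicalSubmodule hy n
  match n with
  | 0 =>
    rw [component_zero, counit_eq_zero_of_mem_radicalSubmodule hy, map_zero]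
    exact zero_mem _
  | 1 =>
    rw [eq_zero_of_mem_radicalSubmodule_of_mem_degreePart_one hn (SetLike.coe_mem _)]
    exact zero_mem _
  | n + 2 =>
    exact TwoSidedIdeal.mem_asIdeal.2
      (TwoSidedIdeal.subset_span ⟨hn, n + 2, by lia, SetLike.coe_mem _⟩)

theorem IsBraiding.isHopfIdeal_radical (h : IsBraiding r) : IsHopfIdeal r h.radical := by
  refine ⟨⟨_, fun s hs => hs.2, h.radical_eq_span⟩, fun y hy => ?_⟩
  simp only [h.mem_radical] at hy ⊢
  exact h.coproduct_mem_of_mem_radicalSubmodule hy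

theorem IsHopfIdeal.counit_and_linCoeff_eq_zero {I : TwoSidedIdeal (FreeAlgebra K ι)}
    (hI : IsHopfIdeal r I) {y : FreeAlgebra K ι} (hy : y ∈ I) :
    counit y = 0 ∧ ∀ m, linCoeff m y = 0 := by
  obtain ⟨⟨S, hS, rfl⟩, -⟩ := hI
  induction hy using TwoSidedIdeal.span_induction with
  | mem s hs =>
    obtain ⟨n, hn, hs⟩ := hS s hs
    obtain ⟨n, rfl⟩ := Nat.exists_eq_add_of_le' hn
    exact ⟨degreePart_succ_le_ker_counit (n + 1) hs,
      fun m => degreePart_add_two_le_ker_linCoeff n m hs⟩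
  | zero => simp
  | add u v _ _ hu hv => simp [hu, hv]
  | neg u _ hu => simp [hu]
  | left_absorb a u _ hu => simp [hu, linCoeff_mul]
  | right_absorb a u _ hu => simp [hu, linCoeff_mul]

theorem IsHopfIdeal.skewDer_mem {I : TwoSidedIdeal (FreeAlgebra K ι)} (hI : IsHopfIdeal r I)
    {y : FreeAlgebra K ι} (hy : y ∈ I) (m : ι) : skewDer r m y ∈ I := by
  rw [← TwoSidedIdeal.mem_asIdeal, ← Submodule.restrictScalars_mem K, skewDer,
    LinearMap.comp_apply, ← Submodule.mem_comap]
  refine Submodule.span_le.2 ?_ (hI.2 y hy)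
  rintro _ ⟨u, v, huv, rfl⟩
  rw [SetLike.mem_coe, Submodule.mem_comap, slice_tmul]
  rcases huv with hu | hv
  · exact Submodule.smul_mem _ _ (TwoSidedIdeal.mem_asIdeal.2 hu)
  · rw [(hI.counit_and_linCoeff_eq_zero hv).2, zero_smul]
    exact zero_mem _

theorem IsHopfIdeal.mem_radicalSubmodule {I : TwoSidedIdeal (FreeAlgebra K ι)}
    (hI : IsHopfIdeal r I) {y : FreeAlgebra K ι} (hy : y ∈ I) : y ∈ radicalSubmodule r := by
  rw [← TwoSidedIdeal.mem_asIdeal, ← Submodule.restrictScalars_mem K] at hy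
  exact le_radicalSubmodule
    (fun u hu => (hI.counit_and_linCoeff_eq_zero (TwoSidedIdeal.mem_asIdeal.1 hu)).1)
    (fun m u hu => TwoSidedIdeal.mem_asIdeal.2 (hI.skewDer_mem (TwoSidedIdeal.mem_asIdeal.1 hu) m))
    hy

theorem IsBraiding.nicholsIdeal_eq (h : IsBraiding r) : nicholsIdeal r = h.radical :=
  le_antisymm (sSup_le fun _ hI _ hy => h.mem_radical.2 (hI.mem_radicalSubmodule hy))
    (le_sSup h.isHopfIdeal_radical)

end NicholsIdeal

section CommutingEvaluation

variable {K : Type*} [CommRing K] {A : Type*} [Ring A] [Algebra K A] {σ : Type*}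

open scoped IsMulCommutative in
/-- Evaluation of polynomials at a commuting family of elements of a noncommutative algebra. -/
def commAeval (y : σ → A) (hy : ∀ i j, Commute (y i) (y j)) : MvPolynomial σ K →ₐ[K] A :=
  haveI : IsMulCommutative (Algebra.adjoin K (Set.range y)) :=
    Algebra.isMulCommutative_adjoin K (by rintro _ ⟨i, rfl⟩ _ ⟨j, rfl⟩; exact hy i j)
  (Algebra.adjoin K (Set.range y)).val.comp
    (MvPolynomial.aeval fun i => (⟨y i, Algebra.subset_adjoin ⟨i, rfl⟩⟩ :
      Algebra.adjoin K (Set.range y)))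

theorem commAeval_X (y : σ → A) (hy : ∀ i j, Commute (y i) (y j)) (i : σ) :
    commAeval (K := K) y hy (MvPolynomial.X i) = y i := by
  simp [commAeval]

end CommutingEvaluation

section Derivations

open MvPolynomial

variable {K : Type*} [CommRing K] {σ : Type*}

theorem derivation_eq_sum_pderiv (D : Derivation K (MvPolynomial σ K) (MvPolynomial σ K))
    {s : Finset σ} {f : MvPolynomial σ K} (hf : f ∈ supported K (s : Set σ)) :
    D f = ∑ i ∈ s, pderiv i f * D (X i) := by
  classical
  induction hf using Algebra.adjoin_induction with
  | mem _ h =>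
    obtain ⟨i, hi, rfl⟩ := h
    simp only [pderiv_X, Pi.single_apply, ite_mul, one_mul, zero_mul, Finset.sum_ite_eq]
    exact (if_pos hi).symm
  | algebraMap c => simp [derivation_C]
  | add f g _ _ hf hg => simp only [map_add, hf, hg, add_mul, Finset.sum_add_distrib]
  | mul f g _ _ hf hg =>
    simp only [Derivation.leibniz, hf, hg, smul_eq_mul, Finset.mul_sum, add_mul,
      Finset.sum_add_distrib, mul_assoc]

theorem pderiv_mem_supported {s : Set σ} {f : MvPolynomial σ K} (hf : f ∈ supported K s) (i : σ) :
    pderiv i f ∈ supported K s := by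
  classical
  induction hf using Algebra.adjoin_induction with
  | mem _ h =>
    obtain ⟨j, -, rfl⟩ := h
    rw [pderiv_X, Pi.single_apply]
    split_ifs
    exacts [one_mem _, zero_mem _]
  | algebraMap c => rw [algebraMap_eq, pderiv_C]; exact zero_mem _
  | add f g _ _ hf hg => rw [map_add]; exact add_mem hf hg
  | mul f g hf' hg' hf hg => rw [pderiv_mul]; exact add_mem (mul_mem hf hg') (mul_mem hf' hg)

theorem eq_zero_of_pderiv_stable [CharZero K] [NoZeroDivisors K] {S : Set (MvPolynomial σ K)}
    (constantCoeff_eq : ∀ f ∈ S, constantCoeff f = 0) (pderiv_mem : ∀ f ∈ S, ∀ i, pderiv i f ∈ S)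
    {f : MvPolynomial σ K} (hf : f ∈ S) : f = 0 := by
  suffices ∀ n (m : σ →₀ ℕ), m.degree = n → ∀ f ∈ S, coeff m f = 0 by
    ext m
    exact this _ m rfl f hf
  intro n
  induction n with
  | zero =>
    intro m hm f hf
    rw [(Finsupp.degree_eq_zero_iff m).1 hm]
    exact constantCoeff_eq f hf
  | succ n ih =>
    intro m hm f hf
    have hne : m ≠ 0 := by rintro rfl; simp at hm
    obtain ⟨i, hi⟩ := Finsupp.ne_iff.1 hne
    obtain ⟨m, rfl⟩ := exists_add_of_le
      (Finsupp.single_le_iff.2 (Nat.one_le_iff_ne_zero.2 hi) : Finsupp.single i 1 ≤ m)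
    rw [add_comm] at hm ⊢
    rw [map_add, Finsupp.degree_single, Nat.succ_inj] at hm
    have hcoeff := ih m hm _ (pderiv_mem f hf i)
    rw [coeff_pderiv] at hcoeff
    exact (mul_eq_zero.1 hcoeff).resolve_right (Nat.cast_add_one_ne_zero _)

/-- The derivation `e_k` of `K[X_0, X_1, …]` with `e_k X_0 = 0` and
`e_k X_{n+1} = n (n-1) ⋯ (n-k+1) ρ_n X_0^{n-k}`.  On a Nichols algebra of type `R_{1,2}`, the
skew derivation along `x_2` acts as `e_0` on polynomials in a suitable commuting family. -/
def lowering (ρ : ℕ → K) (k : ℕ) : Derivation K (MvPolynomial ℕ K) (MvPolynomial ℕ K) :=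
  mkDerivation K fun i => Nat.casesOn i 0 fun n => C (ρ n * n.descFactorial k) * X 0 ^ (n - k)

theorem lowering_X_zero (ρ : ℕ → K) (k : ℕ) : lowering ρ k (X 0) = 0 :=
  mkDerivation_X _ _ _

theorem lowering_X_succ (ρ : ℕ → K) (k n : ℕ) :
    lowering ρ k (X (n + 1)) = C (ρ n * n.descFactorial k) * X 0 ^ (n - k) :=
  mkDerivation_X _ _ _

theorem lowering_succ (ρ : ℕ → K) (k : ℕ) :
    lowering ρ (k + 1) = ⁅(pderiv 0 : Derivation K (MvPolynomial ℕ K) _), lowering ρ k⁆ := by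
  refine derivation_ext fun i => ?_
  rw [Derivation.commutator_apply]
  cases i with
  | zero => simp [lowering_X_zero]
  | succ n =>
    rw [lowering_X_succ, lowering_X_succ, pderiv_X_of_ne n.succ_ne_zero, map_zero, sub_zero,
      pderiv_C_mul, pderiv_pow, pderiv_X_self, mul_one, Nat.descFactorial_succ, Nat.sub_sub]
    push_cast
    simp only [map_mul, map_natCast]
    ring

theorem lowering_mem {ρ : ℕ → K} {I : Ideal (MvPolynomial ℕ K)}
    (pderiv_mem : ∀ f ∈ I, pderiv 0 f ∈ I) (lowering_zero_mem : ∀ f ∈ I, lowering ρ 0 f ∈ I)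
    (k : ℕ) {f : MvPolynomial ℕ K} (hf : f ∈ I) : lowering ρ k f ∈ I := by
  induction k generalizing f with
  | zero => exact lowering_zero_mem f hf
  | succ k ih =>
    rw [lowering_succ, Derivation.commutator_apply]
    exact sub_mem (pderiv_mem _ (ih hf)) (ih (pderiv_mem f hf))

theorem lowering_eq_sum (ρ : ℕ → K) (k : ℕ) {N : ℕ} {f : MvPolynomial ℕ K}
    (hf : f ∈ supported K {i | i ≤ N + 1}) :
    lowering ρ k f = ∑ n ∈ Finset.range (N + 1),
      pderiv (n + 1) f * (C (ρ n * n.descFactorial k) * X 0 ^ (n - k)) := by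
  have hs : {i | i ≤ N + 1} = ((Finset.range (N + 2) : Finset ℕ) : Set ℕ) := by
    ext i
    simp [Nat.lt_succ_iff]
  rw [hs] at hf
  rw [derivation_eq_sum_pderiv _ hf, Finset.sum_range_succ', lowering_X_zero, mul_zero, add_zero]
  simp only [lowering_X_succ]

end Derivations

section Lowering

open MvPolynomial

variable {K : Type*} [Field K] [CharZero K]

/- The sum in `lowering_eq_sum` starts at `n = k`, so the `∂_{n+1} f` are obtained from the
`lowering ρ k f` by descending induction on `n`. -/
theorem pderiv_succ_mem {ρ : ℕ → K} {N : ℕ} (hρ : ∀ n ≤ N, ρ n ≠ 0)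
    {I : Ideal (MvPolynomial ℕ K)} {f : MvPolynomial ℕ K} (lowering_mem : ∀ k, lowering ρ k f ∈ I)
    (hf : f ∈ supported K {i | i ≤ N + 1}) {n : ℕ} (hn : n ≤ N) : pderiv (n + 1) f ∈ I := by
  induction n using Nat.strong_decreasing_induction with
  | base => exact ⟨N, fun m hm hmN => absurd hmN hm.not_ge⟩
  | step n ih =>
    have hmem := lowering_mem n
    rw [lowering_eq_sum ρ n hf, ← Finset.add_sum_erase _ _ (Finset.mem_range_succ_iff.2 hn),
      Ideal.add_mem_iff_left] at hmem
    · rw [Nat.sub_self, pow_zero, mul_one] at hmem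
      refine (Ideal.mul_unit_mem_iff_mem _ (IsUnit.map C (IsUnit.mk0 _ ?_))).1 hmem
      exact mul_ne_zero (hρ n hn) (Nat.cast_ne_zero.2
        ((Nat.descFactorial_self n).trans_ne n.factorial_ne_zero))
    · refine Ideal.sum_mem _ fun m hm => ?_
      rw [Finset.mem_erase, Finset.mem_range_succ_iff] at hm
      rcases lt_or_gt_of_ne hm.1 with hlt | hgt
      · simp [Nat.descFactorial_eq_zero_iff_lt.2 hlt]
      · exact I.mul_mem_right _ (ih m hgt hm.2)

theorem eq_zero_of_lowering_stable {ρ : ℕ → K} {N : ℕ} (hρ : ∀ n ≤ N, ρ n ≠ 0)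
    {I : Ideal (MvPolynomial ℕ K)} (constantCoeff_eq : ∀ f ∈ I, constantCoeff f = 0)
    (pderiv_mem : ∀ f ∈ I, pderiv 0 f ∈ I) (lowering_zero_mem : ∀ f ∈ I, lowering ρ 0 f ∈ I)
    {f : MvPolynomial ℕ K} (hf : f ∈ I) (hs : f ∈ supported K {i | i ≤ N + 1}) : f = 0 := by
  refine eq_zero_of_pderiv_stable (S := I ∩ supported K {i | i ≤ N + 1})
    (fun f hf => constantCoeff_eq f hf.1)
    (fun f hf i => ⟨?_, pderiv_mem_supported hf.2 i⟩) ⟨hf, hs⟩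
  rcases i with - | n
  · exact pderiv_mem f hf.1
  by_cases hn : n ≤ N
  · exact pderiv_succ_mem hρ (lowering_mem pderiv_mem lowering_zero_mem · hf.1) hf.2 hn
  · rw [pderiv_eq_zero_of_notMem_vars]
    · exact zero_mem _
    · exact fun hmem => hn (Nat.succ_le_succ_iff.1 (mem_supported.1 hf.2 hmem))

end Lowering

section InducedMaps

variable {K : Type*} [Field K] {ι : Type*} [Fintype ι] [DecidableEq ι]
  {r : ι → ι → Matrix ι ι K}

theorem mk_eq_zero_iff {A : Type*} [Ring A] [Algebra K A] {I : TwoSidedIdeal A} {y : A} :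
    I.ringCon.mkₐ (α := K) y = 0 ↔ y ∈ I := by
  rw [TwoSidedIdeal.mem_iff, ← RingCon.eq]
  rfl

theorem proj_surjective : Function.Surjective (proj r) :=
  RingCon.mkₐ_surjective _

theorem proj_eq_zero_iff {y : FreeAlgebra K ι} : proj r y = 0 ↔ y ∈ nicholsIdeal r :=
  mk_eq_zero_iff

theorem IsBraiding.proj_eq_zero_iff (h : IsBraiding r) {y : FreeAlgebra K ι} :
    proj r y = 0 ↔ y ∈ radicalSubmodule r := by
  rw [Nichols.proj_eq_zero_iff, h.nicholsIdeal_eq, h.mem_radical]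

theorem IsBraiding.ringCon_le_ker (h : IsBraiding r) {A : Type*} [Ring A] [Algebra K A]
    (f : FreeAlgebra K ι →ₐ[K] A) (hf : ∀ y ∈ radicalSubmodule r, f y = 0) :
    (nicholsIdeal r).ringCon ≤ RingCon.ker f.toRingHom := by
  intro y z hyz
  rw [RingCon.ker_apply, ← sub_eq_zero, ← map_sub]
  refine hf _ (h.mem_radical.1 ?_)
  rwa [← h.nicholsIdeal_eq, ← TwoSidedIdeal.rel_iff]

/-- The counit of the Nichols algebra. -/
def IsBraiding.inducedCounit (h : IsBraiding r) : NicholsAlgebra r →ₐ[K] K :=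
  RingCon.liftₐ _ counit (h.ringCon_le_ker _ fun _ => counit_eq_zero_of_mem_radicalSubmodule)

theorem IsBraiding.inducedCounit_proj (h : IsBraiding r) (y : FreeAlgebra K ι) :
    h.inducedCounit (proj r y) = counit y :=
  rfl

/-- The braiding `V ⊗ B(V) → B(V) ⊗ V`, as a matrix of linear forms; cf. `braidGen`. -/
def IsBraiding.inducedBraid (h : IsBraiding r) :
    NicholsAlgebra r →ₐ[K] Matrix ι ι (NicholsAlgebra r) :=
  RingCon.liftₐ _ ((proj r).mapMatrix.comp (braidGen r)) <| h.ringCon_le_ker _ fun _ hy =>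
    Matrix.ext fun i m => h.proj_eq_zero_iff.2 (h.braidGen_mem_radicalSubmodule hy i m)

theorem IsBraiding.inducedBraid_proj (h : IsBraiding r) (y : FreeAlgebra K ι) (i m : ι) :
    h.inducedBraid (proj r y) i m = proj r (braidGen r y i m) :=
  rfl

/-- The skew derivation `∂_m` of the Nichols algebra. -/
def IsBraiding.inducedSkewDer (h : IsBraiding r) (m : ι) :
    NicholsAlgebra r →ₗ[K] NicholsAlgebra r :=
  (LinearMap.ker (proj r).toLinearMap).liftQ ((proj r).toLinearMap ∘ₗ skewDer r m) (fun _ hy =>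
      h.proj_eq_zero_iff.2 (skewDer_mem_radicalSubmodule (h.proj_eq_zero_iff.1 hy) m)) ∘ₗ
    ((proj r).toLinearMap.quotKerEquivOfSurjective proj_surjective).symm.toLinearMap

theorem IsBraiding.inducedSkewDer_proj (h : IsBraiding r) (m : ι) (y : FreeAlgebra K ι) :
    h.inducedSkewDer m (proj r y) = proj r (skewDer r m y) := by
  have : ((proj r).toLinearMap.quotKerEquivOfSurjective proj_surjective).symm (proj r y) =
      Submodule.Quotient.mk y := by
    rw [LinearEquiv.symm_apply_eq]
    rfl
  rw [inducedSkewDer, LinearMap.comp_apply, LinearEquiv.coe_coe, this]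
  rfl

theorem IsBraiding.inducedSkewDer_one (h : IsBraiding r) (m : ι) :
    h.inducedSkewDer m 1 = 0 := by
  rw [← map_one (proj r), h.inducedSkewDer_proj, skewDer_one, map_zero]

theorem IsBraiding.inducedSkewDer_ι (h : IsBraiding r) (m i : ι) :
    h.inducedSkewDer m (proj r (FreeAlgebra.ι K i)) = if i = m then 1 else 0 := by
  rw [h.inducedSkewDer_proj, skewDer_ι, apply_ite (proj r), map_one, map_zero]

theorem IsBraiding.inducedSkewDer_mul (h : IsBraiding r) (m : ι) (u v : NicholsAlgebra r) :
    h.inducedSkewDer m (u * v) =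
      u * h.inducedSkewDer m v + ∑ i, h.inducedSkewDer i u * h.inducedBraid v i m := by
  obtain ⟨y, rfl⟩ := proj_surjective u
  obtain ⟨z, rfl⟩ := proj_surjective v
  simp only [← map_mul, h.inducedSkewDer_proj, h.inducedBraid_proj, skewDer_mul, map_add, map_sum]

theorem IsBraiding.eq_of_inducedSkewDer_eq (h : IsBraiding r) {u v : NicholsAlgebra r}
    (counit_eq : h.inducedCounit u = h.inducedCounit v)
    (skewDer_eq : ∀ m, h.inducedSkewDer m u = h.inducedSkewDer m v) : u = v := by
  obtain ⟨y, rfl⟩ := proj_surjective u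
  obtain ⟨z, rfl⟩ := proj_surjective v
  rw [← sub_eq_zero, ← map_sub, h.proj_eq_zero_iff, mem_radicalSubmodule_iff]
  refine ⟨?_, fun m => ?_⟩
  · rw [map_sub, sub_eq_zero]
    exact counit_eq
  · rw [← h.proj_eq_zero_iff, map_sub, map_sub, sub_eq_zero, ← h.inducedSkewDer_proj, skewDer_eq,
      h.inducedSkewDer_proj]

end InducedMaps

section BraidOperator

variable {K : Type*} [Field K] {ι : Type*} [Fintype ι]

/-- The braiding as an operator on functions of two indices; the braid equation is easier to check
for these operators than entry by entry. -/
def braidOp (r : ι → ι → Matrix ι ι K) (i j : ι) (F : ι → ι → K) : K :=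
  ∑ l, ∑ m, r i j l m * F l m

theorem isBraiding_of_braidOp {r : ι → ι → Matrix ι ι K}
    (h : ∀ a b j (F : ι → ι → ι → K),
      braidOp r a b (fun i i' => braidOp r i' j fun s n => braidOp r i s fun l m => F l m n) =
        braidOp r b j fun s i' => braidOp r a s fun l i => braidOp r i i' fun m n => F l m n) :
    IsBraiding r := by
  classical
  intro a b j l m n
  have hF := h a b j fun l' m' n' =>
    (if l' = l then 1 else 0) * ((if m' = m then 1 else 0) * (if n' = n then 1 else 0))
  simp only [braidOp, mul_ite, mul_one, mul_zero, Finset.sum_ite_irrel, Finset.sum_ite_eq',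
    Finset.mem_univ, if_true, Finset.sum_const_zero, Finset.mul_sum] at hF
  rw [hF, Finset.sum_comm_cycle]
  refine Finset.sum_congr rfl fun i _ => Finset.sum_comm.trans ?_
  refine Finset.sum_congr rfl fun i' _ => Finset.sum_congr rfl fun s _ => ?_
  ring

theorem isBraiding_R12 (a b p q k : K) : IsBraiding (R12 1 a b p q k) := by
  have braidOp_eq (i j : Fin 3) (F : Fin 3 → Fin 3 → K) : braidOp (R12 1 a b p q k) i j F =
      match i, j with
      | 0, 0 => F 0 0
      | 0, 1 => F 1 0
      | 0, 2 => p * F 0 0 + F 2 0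
      | 1, 0 => F 0 1
      | 1, 1 => F 1 1
      | 1, 2 => q * F 0 1 + F 2 1
      | 2, 0 => b * F 0 0 + F 0 2
      | 2, 1 => (p - q) * F 0 1 + b * F 1 0 + F 1 2
      | 2, 2 => a * F 0 0 + k * (F 0 1 - F 1 0) + p * F 0 2 + b * F 2 0 + F 2 2 := by
    fin_cases i <;> fin_cases j <;> simp [braidOp, R12, Fin.sum_univ_three] <;> ring
  refine isBraiding_of_braidOp fun i j l F => ?_
  fin_cases i <;> fin_cases j <;> fin_cases l <;>
    simp only [Fin.zero_eta, Fin.mk_one, Fin.reduceFinMk, braidOp_eq] <;> ring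

end BraidOperator

section R12

variable {K : Type*} [Field K] {a b p q k : K}

local notation "𝔅" => NicholsAlgebra (R12 1 a b p q k)
local notation "π" => proj (R12 1 a b p q k)
local notation "x₁" => proj (R12 1 a b p q k) (x K 0)
local notation "x₂" => proj (R12 1 a b p q k) (x K 1)
local notation "x₃" => proj (R12 1 a b p q k) (x K 2)
local notation "ε" => IsBraiding.inducedCounit (isBraiding_R12 a b p q k)
local notation "𝔠" => IsBraiding.inducedBraid (isBraiding_R12 a b p q k)
local notation "∂" => IsBraiding.inducedSkewDer (isBraiding_R12 a b p q k)

theorem braid_x₁ : 𝔠 x₁ = !![x₁, 0, 0; 0, x₁, 0; b • x₁, 0, x₁] := by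
  ext i m
  rw [IsBraiding.inducedBraid_proj, braidGen_ι]
  fin_cases i <;> fin_cases m <;> simp [Fin.sum_univ_three, R12]

theorem braid_x₂ : 𝔠 x₂ = !![x₂, 0, 0; 0, x₂, 0; b • x₂, (p - q) • x₁, x₂] := by
  ext i m
  rw [IsBraiding.inducedBraid_proj, braidGen_ι]
  fin_cases i <;> fin_cases m <;> simp [Fin.sum_univ_three, R12]

theorem braid_x₃ : 𝔠 x₃ =
    !![x₃ + p • x₁, 0, 0; 0, x₃ + q • x₁, 0;
      b • x₃ + a • x₁ - k • x₂, k • x₁, x₃ + p • x₁] := by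
  ext i m
  rw [IsBraiding.inducedBraid_proj, braidGen_ι]
  fin_cases i <;> fin_cases m <;> simp [Fin.sum_univ_three, R12] <;> abel

theorem counit_x (i : Fin 3) : ε (π (x K i)) = 0 := by
  rw [IsBraiding.inducedCounit_proj, counit_ι]

theorem skewDer_x (m i : Fin 3) : ∂ m (π (x K i)) = if i = m then 1 else 0 :=
  IsBraiding.inducedSkewDer_ι _ m i

theorem commute_x₁_x₂ : Commute x₁ x₂ := by
  refine (isBraiding_R12 a b p q k).eq_of_inducedSkewDer_eq (by simp [counit_x]) fun m => ?_
  fin_cases m <;>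
    simp [IsBraiding.inducedSkewDer_mul, skewDer_x, braid_x₁, braid_x₂]

section CharZero

variable [CharZero K]

theorem x₃_mul_x₁ : x₃ * x₁ = x₁ * x₃ + ((b - p) / 2) • x₁ ^ 2 := by
  refine (isBraiding_R12 a b p q k).eq_of_inducedSkewDer_eq (by simp [counit_x]) fun m => ?_
  fin_cases m <;> simp [IsBraiding.inducedSkewDer_mul, skewDer_x, braid_x₁, braid_x₃,
    pow_two]
  module

theorem x₃_mul_x₁_pow (n : ℕ) :
    x₃ * x₁ ^ n = x₁ ^ n * x₃ + ((n : K) * ((b - p) / 2)) • x₁ ^ (n + 1) := by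
  induction n with
  | zero => simp
  | succ n ih =>
    rw [pow_succ, ← mul_assoc, ih, add_mul, mul_assoc, x₃_mul_x₁, mul_add, smul_mul_assoc,
      mul_smul_comm, ← pow_add, ← pow_succ, ← mul_assoc, ← pow_succ]
    push_cast
    module

end CharZero

/-- The elements `v_0 = x_2` and `v_{n+1} = x_3 v_n - v_n x_3 - (n + 1) b x_1 v_n`. They differ from
the `z_n` by multiples of `x_1 v_{n-1}, …, x_1^n v_0`, but are simpler to differentiate. -/
def v (b : K) : ℕ → FreeAlgebra K (Fin 3)
  | 0 => x K 1
  | n + 1 => x K 2 * v b n - v b n * x K 2 - (((n : K) + 1) * b) • (x K 0 * v b n)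

/-- The coefficient of `x_1 ^ n` in `∂_2 v_n`; as indices here start at `0`, `∂_2` is
`inducedSkewDer 1`. -/
def rho (b p q : K) (n : ℕ) : K :=
  ((n : K) + 1) * ∏ j ∈ Finset.range n, ((p - b) / 2 - q - (j : K) * ((b + p) / 2))

/-- The coefficient of `x_1 ^ (n + 1) ⊗ x_2` in `c (x_3 ⊗ v_n)`. -/
def gamma (b p q : K) (n : ℕ) : K :=
  ∏ j ∈ Finset.range (n + 1), (p - q - (j : K) * ((b + p) / 2))

theorem gamma_succ (n : ℕ) :
    gamma b p q (n + 1) = gamma b p q n * (p - q - ((n : K) + 1) * ((b + p) / 2)) := by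
  rw [gamma, Finset.prod_range_succ, ← gamma, Nat.cast_succ]

theorem proj_v_succ (n : ℕ) : π (v b (n + 1)) =
    x₃ * π (v b n) - π (v b n) * x₃ - (((n : K) + 1) * b) • (x₁ * π (v b n)) := by
  simp only [v, map_sub, map_mul, map_smul]

theorem counit_v (n : ℕ) : ε (π (v b n)) = 0 := by
  cases n with
  | zero => exact counit_x 1
  | succ n => simp [proj_v_succ, counit_x]

variable [CharZero K]

theorem gamma_eq_prod (n : ℕ) : gamma b p q n =
    (p - q) * ∏ j ∈ Finset.range n, ((p - b) / 2 - q - (j : K) * ((b + p) / 2)) := by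
  rw [gamma, Finset.prod_range_succ', mul_comm, Nat.cast_zero, zero_mul, sub_zero]
  congr 1
  refine Finset.prod_congr rfl fun j _ => ?_
  push_cast
  ring

theorem rho_succ (n : ℕ) : rho b p q (n + 1) =
    rho b p q n * ((n : K) * ((b - p) / 2) - q - ((n : K) + 1) * b) + gamma b p q n := by
  rw [gamma_eq_prod, rho, rho, Finset.prod_range_succ]
  push_cast
  ring

theorem commute_x₁_v (n : ℕ) : Commute x₁ (π (v b n)) := by
  induction n with
  | zero => exact commute_x₁_x₂
  | succ n ih =>
    have bracket : Commute ⁅x₃, π (v b n)⁆ x₁ := by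
      rw [commute_iff_lie_eq, lie_lie_comm ih.symm, ← commute_iff_lie_eq, Ring.lie_def, x₃_mul_x₁,
        add_sub_cancel_left]
      exact (ih.pow_left 2).smul_left _
    rw [proj_v_succ]
    exact bracket.symm.sub_right (((Commute.refl x₁).mul_right ih).smul_right _)

variable (a b p q k) in
/-- The action of the braiding on `v_n`. -/
def vBraid (n : ℕ) : Matrix (Fin 3) (Fin 3) 𝔅 :=
  !![π (v b n), 0, 0; 0, π (v b n), 0;
    (((n : K) + 1) * b) • π (v b n), gamma b p q n • x₁ ^ (n + 1), π (v b n)]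

variable (a b p q k) in
/-- The skew derivatives of `v_n`. -/
def vSkewDer (n : ℕ) : Fin 3 → 𝔅 :=
  ![0, rho b p q n • x₁ ^ n, 0]

theorem commute_v_v_of {m n : ℕ} (hm : 𝔠 (π (v b m)) = vBraid a b p q k m)
    (hn : 𝔠 (π (v b n)) = vBraid a b p q k n) (dm : ∀ i, ∂ i (π (v b m)) = vSkewDer a b p q k m i)
    (dn : ∀ i, ∂ i (π (v b n)) = vSkewDer a b p q k n i) : Commute (π (v b m)) (π (v b n)) := by
  refine (isBraiding_R12 a b p q k).eq_of_inducedSkewDer_eq (by simp [counit_v]) fun i => ?_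
  simp only [IsBraiding.inducedSkewDer_mul, dm, dn, hm, hn, vBraid, vSkewDer, Fin.sum_univ_three]
  fin_cases i <;> simp [((commute_x₁_v _).pow_left _).eq, add_comm]

theorem braid_v_succ {n : ℕ} (hn : 𝔠 (π (v b n)) = vBraid a b p q k n)
    (h₂ : Commute x₂ (π (v b n))) : 𝔠 (π (v b (n + 1))) = vBraid a b p q k (n + 1) := by
  have h₁ : π (v b n) * x₁ = x₁ * π (v b n) := (commute_x₁_v n).eq.symm
  rw [proj_v_succ, map_sub, map_sub, map_smul, map_mul, map_mul, map_mul, hn, braid_x₁, braid_x₃,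
    vBraid, vBraid, proj_v_succ, gamma_succ]
  ext i m
  fin_cases i <;> fin_cases m <;> simp [mul_add, add_mul, mul_sub, sub_mul, h₁, h₂.eq,
    x₃_mul_x₁_pow, ← pow_succ, ← pow_succ'] <;> module

theorem skewDer_v_succ {n : ℕ} (hn : 𝔠 (π (v b n)) = vBraid a b p q k n)
    (dn : ∀ i, ∂ i (π (v b n)) = vSkewDer a b p q k n i) (i : Fin 3) :
    ∂ i (π (v b (n + 1))) = vSkewDer a b p q k (n + 1) i := by
  rw [proj_v_succ, map_sub, map_sub, map_smul]
  simp only [IsBraiding.inducedSkewDer_mul, dn, hn, vBraid, vSkewDer, Fin.sum_univ_three,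
    skewDer_x, braid_x₃, rho_succ]
  fin_cases i <;> simp [mul_add, ← pow_succ, ← pow_succ', x₃_mul_x₁_pow]
  module

theorem braid_v_and_skewDer_v (n : ℕ) : 𝔠 (π (v b n)) = vBraid a b p q k n ∧
    ∀ i, ∂ i (π (v b n)) = vSkewDer a b p q k n i := by
  have base : 𝔠 (π (v b 0)) = vBraid a b p q k 0 ∧
      ∀ i, ∂ i (π (v b 0)) = vSkewDer a b p q k 0 i := by
    refine ⟨?_, fun i => ?_⟩
    · simp [v, vBraid, gamma, braid_x₂]
    · fin_cases i <;> simp [v, vSkewDer, rho, skewDer_x]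
  induction n with
  | zero => exact base
  | succ n ih =>
    exact ⟨braid_v_succ ih.1 (commute_v_v_of base.1 ih.1 base.2 ih.2), skewDer_v_succ ih.1 ih.2⟩

theorem braid_v (n : ℕ) : 𝔠 (π (v b n)) = vBraid a b p q k n :=
  (braid_v_and_skewDer_v n).1

theorem skewDer_v (n : ℕ) (i : Fin 3) : ∂ i (π (v b n)) = vSkewDer a b p q k n i :=
  (braid_v_and_skewDer_v n).2 i

theorem commute_v_v (m n : ℕ) : Commute (π (v b m)) (π (v b n)) :=
  commute_v_v_of (braid_v m) (braid_v n) (skewDer_v m) (skewDer_v n)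

section PolyEval

open MvPolynomial

variable (a b p q k) in
/-- The commuting family `x_1, v_0, v_1, …`. -/
def vFamily : ℕ → 𝔅
  | 0 => x₁
  | n + 1 => π (v b n)

theorem commute_vFamily (i j : ℕ) : Commute (vFamily a b p q k i) (vFamily a b p q k j) := by
  cases i <;> cases j
  · exact Commute.refl _
  · exact commute_x₁_v _
  · exact (commute_x₁_v _).symm
  · exact commute_v_v _ _

variable (a b p q k) in
/-- Evaluation of polynomials at `X_0 = x_1` and `X_{n+1} = v_n`. -/
def polyEval : MvPolynomial ℕ K →ₐ[K] 𝔅 :=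
  commAeval (vFamily a b p q k) commute_vFamily

theorem polyEval_X (i : ℕ) : polyEval a b p q k (X i) = vFamily a b p q k i :=
  commAeval_X _ _ _

theorem commute_polyEval (f g : MvPolynomial ℕ K) :
    Commute (polyEval a b p q k f) (polyEval a b p q k g) :=
  (Commute.all f g).map (polyEval a b p q k)

theorem counit_polyEval (f : MvPolynomial ℕ K) : ε (polyEval a b p q k f) = constantCoeff f := by
  have : (ε).comp (polyEval a b p q k) = aeval 0 := by
    ext i
    rw [AlgHom.comp_apply, polyEval_X, aeval_X]
    cases i with
    | zero => exact counit_x 0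
    | succ n => exact counit_v n
  rw [← AlgHom.comp_apply, this, aeval_zero]
  rfl

theorem skewDer_mul_vFamily (m : Fin 3) {u : 𝔅} (hu : ∂ 2 u = 0) (i : ℕ) :
    ∂ m (u * vFamily a b p q k i) =
      u * ∂ m (vFamily a b p q k i) + ∂ m u * vFamily a b p q k i := by
  rw [IsBraiding.inducedSkewDer_mul, Fin.sum_univ_three, hu]
  cases i with
  | zero =>
    rw [vFamily, braid_x₁]
    fin_cases m <;> simp [hu]
  | succ n =>
    rw [vFamily, braid_v, vBraid]
    fin_cases m <;> simp [hu]

theorem skewDer_two_polyEval (f : MvPolynomial ℕ K) : ∂ 2 (polyEval a b p q k f) = 0 := by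
  induction f using MvPolynomial.induction_on with
  | C c =>
    rw [C_eq_smul_one, map_smul, map_smul, map_one, IsBraiding.inducedSkewDer_one, smul_zero]
  | add f g hf hg => rw [map_add, map_add, hf, hg, add_zero]
  | mul_X f i hf =>
    rw [map_mul, polyEval_X, skewDer_mul_vFamily _ hf, hf, zero_mul, add_zero]
    cases i with
    | zero => rw [vFamily, skewDer_x]; simp
    | succ n => rw [vFamily, skewDer_v]; simp [vSkewDer]

theorem skewDer_polyEval {m : Fin 3} (D : Derivation K (MvPolynomial ℕ K) (MvPolynomial ℕ K))
    (hD : ∀ i, ∂ m (vFamily a b p q k i) = polyEval a b p q k (D (X i))) (f : MvPolynomial ℕ K) :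
    ∂ m (polyEval a b p q k f) = polyEval a b p q k (D f) := by
  induction f using MvPolynomial.induction_on with
  | C c =>
    rw [derivation_C, C_eq_smul_one, map_smul, map_smul, map_one, IsBraiding.inducedSkewDer_one,
      smul_zero, map_zero]
  | add f g hf hg => rw [map_add, map_add, map_add, map_add, hf, hg]
  | mul_X f i hf =>
    rw [map_mul, polyEval_X, skewDer_mul_vFamily _ (skewDer_two_polyEval f), hD, hf,
      ← polyEval_X, (commute_polyEval (D f) _).eq, D.leibniz, smul_eq_mul, smul_eq_mul, map_add,
      map_mul, map_mul]

theorem skewDer_zero_polyEval (f : MvPolynomial ℕ K) :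
    ∂ 0 (polyEval a b p q k f) = polyEval a b p q k (pderiv 0 f) := by
  refine skewDer_polyEval _ (fun i => ?_) f
  cases i with
  | zero => rw [pderiv_X_self, map_one]; exact skewDer_x 0 0
  | succ n => rw [pderiv_X_of_ne n.succ_ne_zero, map_zero]; exact skewDer_v n 0

theorem skewDer_one_polyEval (f : MvPolynomial ℕ K) :
    ∂ 1 (polyEval a b p q k f) = polyEval a b p q k (lowering (rho b p q) 0 f) := by
  refine skewDer_polyEval _ (fun i => ?_) f
  cases i with
  | zero => rw [lowering_X_zero, map_zero]; exact skewDer_x 1 0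
  | succ n =>
    rw [lowering_X_succ, Nat.descFactorial_zero, Nat.cast_one, mul_one, Nat.sub_zero, C_mul',
      map_smul, map_pow, polyEval_X]
    exact skewDer_v n 1

theorem eq_zero_of_polyEval_eq_zero {N : ℕ} (hρ : ∀ n ≤ N, rho b p q n ≠ 0)
    {f : MvPolynomial ℕ K} (hs : f ∈ supported K {i | i ≤ N + 1})
    (hf : polyEval a b p q k f = 0) : f = 0 := by
  refine eq_zero_of_lowering_stable hρ (I := RingHom.ker (polyEval a b p q k)) (fun f hf => ?_)
    (fun f hf => ?_) (fun f hf => ?_) hf hs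
  · rw [← counit_polyEval (a := a) (b := b) (p := p) (q := q) (k := k), RingHom.mem_ker.1 hf,
      map_zero]
  · rw [RingHom.mem_ker, ← skewDer_zero_polyEval, RingHom.mem_ker.1 hf, map_zero]
  · rw [RingHom.mem_ker, ← skewDer_one_polyEval, RingHom.mem_ker.1 hf, map_zero]

end PolyEval

end R12

section Polynomials

open MvPolynomial

variable {K : Type*} [Field K] (b p q : K)

/-- The derivation of `K[X_0, X_1, …]` that corresponds to the commutator with `x_3` under
`X_0 ↦ x_1`, `X_{n+1} ↦ v_n`. -/
def adDer : Derivation K (MvPolynomial ℕ K) (MvPolynomial ℕ K) :=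
  mkDerivation K fun i => Nat.casesOn i (C ((b - p) / 2) * X 0 ^ 2) fun n =>
    X (n + 2) + C (((n : K) + 1) * b) * (X 0 * X (n + 1))

theorem adDer_X_zero : adDer b p (X 0) = C ((b - p) / 2) * X 0 ^ 2 :=
  mkDerivation_X _ _ _

theorem adDer_X_succ (n : ℕ) :
    adDer b p (X (n + 1)) = X (n + 2) + C (((n : K) + 1) * b) * (X 0 * X (n + 1)) := by
  rw [adDer, mkDerivation_X]

/-- The polynomial in `x_1, v_0, …, v_n` that represents `z_n`. -/
def zPoly : ℕ → MvPolynomial ℕ K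
  | 0 => X 1
  | n + 1 => adDer b p (zPoly n) - C (((n : K) + 1) * b) * (X 0 * zPoly n) +
      C ((n.factorial : K) * (q - p) * ((-b - p) / 2) ^ n) * (X 0 ^ (n + 1) * X 1)

theorem adDer_zPoly (n : ℕ) : adDer b p (zPoly b p q n) =
    zPoly b p q (n + 1) + C (((n : K) + 1) * b) * (X 0 * zPoly b p q n) -
      C ((n.factorial : K) * (q - p) * ((-b - p) / 2) ^ n) * (X 0 ^ (n + 1) * X 1) := by
  rw [zPoly.eq_def b p q (n + 1)]
  ring

/-- The polynomial in `x_1, z_0, …, z_n` that represents `v_n`. -/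
def vPoly : ℕ → MvPolynomial ℕ K
  | 0 => X 1
  | n + 1 => X (n + 2) + C (((n : K) + 1) * ((b + p) / 2)) * (X 0 * X (n + 1)) +
      C ((p - b) / 2 - q - (n : K) * ((b + p) / 2)) * (X 0 * vPoly n)

/-- The substitution `v_n ↦ z_n`. -/
def zSubst : MvPolynomial ℕ K →ₐ[K] MvPolynomial ℕ K :=
  aeval fun i => Nat.casesOn i (X 0) fun n => zPoly b p q n

theorem zSubst_X_zero : zSubst b p q (X 0) = X 0 := aeval_X _ _

theorem zSubst_X_succ (n : ℕ) : zSubst b p q (X (n + 1)) = zPoly b p q n := aeval_X _ _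

/-- The substitution `z_n ↦ v_n`. -/
def vSubst : MvPolynomial ℕ K →ₐ[K] MvPolynomial ℕ K :=
  aeval fun i => Nat.casesOn i (X 0) fun n => vPoly b p q n

theorem vSubst_X_zero : vSubst b p q (X 0) = X 0 := aeval_X _ _

theorem vSubst_X_succ (n : ℕ) : vSubst b p q (X (n + 1)) = vPoly b p q n := aeval_X _ _

variable [CharZero K]

theorem zPoly_succ_add (n : ℕ) :
    zPoly b p q (n + 1) + C (((n : K) + 1) * ((b + p) / 2)) * (X 0 * zPoly b p q n) =
      X (n + 2) - C ((p - b) / 2 - q - (n : K) * ((b + p) / 2)) * (X 0 * X (n + 1)) := by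
  have half : (C (2⁻¹ : K) : MvPolynomial ℕ K) * 2 = 1 := by
    rw [← map_ofNat (C : K →+* MvPolynomial ℕ K) 2, ← C_mul, inv_mul_cancel₀ two_ne_zero, C_1]
  induction n with
  | zero =>
    simp only [zPoly, adDer_X_succ, div_eq_mul_inv, C_add, C_sub, C_mul, C_1,
      Nat.factorial, pow_zero, map_zero, Nat.cast_one, Nat.cast_zero]
    linear_combination (C p * X 0 * X 1 : MvPolynomial ℕ K) * half
  | succ n ih =>
    have ad_ih := congrArg (adDer b p) ih
    simp only [map_add, map_sub, derivation_C, Derivation.leibniz, adDer_X_zero, adDer_X_succ,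
      adDer_zPoly, smul_eq_mul] at ad_ih
    simp only [Nat.factorial_succ, Nat.cast_mul] at ad_ih ih ⊢
    simp only [div_eq_mul_inv, C_add, C_sub, C_mul, C_neg, C_1, C_pow, map_natCast, Nat.cast_add,
      Nat.cast_one] at ad_ih ih ⊢
    linear_combination ad_ih - ((n + 1) * C b + (C b - C p) * C 2⁻¹) * X 0 * ih +
      C b * X 0 * (zPoly b p q (n + 1) - X (n + 2)) * half

theorem zPoly_mem_supported (n : ℕ) : zPoly b p q n ∈ supported K {i | i ≤ n + 1} := by
  induction n with
  | zero => exact X_mem_supported.2 (le_refl 1)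
  | succ n ih =>
    have const_mem (c : K) : C c ∈ supported K {i | i ≤ n + 2} := Subalgebra.algebraMap_mem _ c
    have X_mem {i : ℕ} (hi : i ≤ n + 2) : (X i : MvPolynomial ℕ K) ∈ supported K {i | i ≤ n + 2} :=
      X_mem_supported.2 hi
    have prev_mem : zPoly b p q n ∈ supported K {i | i ≤ n + 2} :=
      supported_mono (fun i (hi : i ≤ n + 1) => hi.trans (Nat.le_succ _)) ih
    rw [eq_sub_of_add_eq (zPoly_succ_add b p q n)]
    exact sub_mem (sub_mem (X_mem le_rfl) (mul_mem (const_mem _) (mul_mem (X_mem (by lia))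
      (X_mem (by lia))))) (mul_mem (const_mem _) (mul_mem (X_mem (by lia)) prev_mem))

theorem vSubst_zPoly (n : ℕ) : vSubst b p q (zPoly b p q n) = X (n + 1) := by
  induction n with
  | zero => exact vSubst_X_succ b p q 0
  | succ n ih =>
    have subst := congrArg (vSubst b p q) (zPoly_succ_add b p q n)
    simp only [map_add, map_sub, map_mul, vSubst_X_zero, vSubst_X_succ, ih, vPoly,
      algHom_C, algebraMap_eq] at subst
    linear_combination subst

theorem zSubst_injective : Function.Injective (zSubst b p q) := by
  have left_inv : (vSubst b p q).comp (zSubst b p q) = AlgHom.id K _ := by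
    refine MvPolynomial.algHom_ext fun i => ?_
    cases i with
    | zero => simp only [AlgHom.comp_apply, zSubst_X_zero, vSubst_X_zero, AlgHom.id_apply]
    | succ n => simp only [AlgHom.comp_apply, zSubst_X_succ, vSubst_zPoly, AlgHom.id_apply]
  exact Function.LeftInverse.injective (g := vSubst b p q) (DFunLike.congr_fun left_inv)

theorem zSubst_mem_supported {N : ℕ} {f : MvPolynomial ℕ K}
    (hf : f ∈ supported K {i | i ≤ N + 1}) : zSubst b p q f ∈ supported K {i | i ≤ N + 1} := by
  suffices supported K {i | i ≤ N + 1} ≤ (supported K {i | i ≤ N + 1}).comap (zSubst b p q) from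
    this hf
  refine Algebra.adjoin_le ?_
  rintro _ ⟨i, hi, rfl⟩
  rw [SetLike.mem_coe, Subalgebra.mem_comap]
  cases i with
  | zero => rw [zSubst_X_zero]; exact X_mem_supported.2 (Nat.zero_le _)
  | succ n =>
    rw [zSubst_X_succ]
    exact supported_mono (fun j (hj : j ≤ n + 1) => hj.trans hi) (zPoly_mem_supported b p q n)

end Polynomials

section R12

open MvPolynomial

variable {K : Type*} [Field K] [CharZero K] {a b p q k : K}

local notation "𝔅" => NicholsAlgebra (R12 1 a b p q k)
local notation "π" => proj (R12 1 a b p q k)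
local notation "x₁" => proj (R12 1 a b p q k) (x K 0)
local notation "x₃" => proj (R12 1 a b p q k) (x K 2)
local notation "∂" => IsBraiding.inducedSkewDer (isBraiding_R12 a b p q k)

theorem x₃_mul_vFamily (i : ℕ) : x₃ * vFamily a b p q k i =
    vFamily a b p q k i * x₃ + polyEval a b p q k (adDer b p (X i)) := by
  cases i with
  | zero =>
    rw [adDer_X_zero, C_mul', map_smul, map_pow, polyEval_X]
    exact x₃_mul_x₁
  | succ n =>
    rw [adDer_X_succ, map_add, C_mul', map_smul, map_mul, polyEval_X, polyEval_X, polyEval_X]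
    simp only [vFamily, proj_v_succ]
    abel

theorem x₃_mul_polyEval (f : MvPolynomial ℕ K) : x₃ * polyEval a b p q k f =
    polyEval a b p q k f * x₃ + polyEval a b p q k (adDer b p f) := by
  induction f using MvPolynomial.induction_on with
  | C c =>
    rw [derivation_C, map_zero, add_zero, C_eq_smul_one, map_smul, map_one, smul_mul_assoc,
      mul_smul_comm, one_mul, mul_one]
  | add f g hf hg => rw [map_add, mul_add, hf, hg, map_add, map_add, add_mul]; abel
  | mul_X f i hf =>
    rw [map_mul, ← mul_assoc, hf, add_mul, mul_assoc, polyEval_X, x₃_mul_vFamily, ← polyEval_X,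
      mul_add, Derivation.leibniz, smul_eq_mul, smul_eq_mul, map_add, map_mul, map_mul,
      (commute_polyEval (X i) _).eq, mul_assoc, add_assoc]

theorem polyEval_zPoly (n : ℕ) : polyEval a b p q k (zPoly b p q n) = π (z b p q n) := by
  induction n with
  | zero => exact polyEval_X 1
  | succ n ih =>
    rw [zPoly, z, map_add, map_sub, C_mul', C_mul', map_smul, map_smul, map_mul, map_mul, map_pow,
      polyEval_X, polyEval_X, eq_sub_of_add_eq' (x₃_mul_polyEval _).symm, ih, map_add,
      map_sub, sub_mul, map_sub, smul_mul_assoc]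
    simp only [map_mul, map_smul, map_pow, vFamily, v]
    abel

theorem commute_proj_z (m n : ℕ) : Commute (π (z b p q m)) (π (z b p q n)) := by
  rw [← polyEval_zPoly, ← polyEval_zPoly]
  exact commute_polyEval _ _

theorem proj_v_eq_zero {n : ℕ} (h : rho b p q n = 0) : π (v b n) = 0 := by
  refine (isBraiding_R12 a b p q k).eq_of_inducedSkewDer_eq ?_ fun i => ?_
  · rw [counit_v, map_zero]
  · rw [skewDer_v, vSkewDer, h, zero_smul, map_zero]
    fin_cases i <;> rfl

theorem proj_z_succ_add {n : ℕ} (h : (p - b) / 2 - q - (n : K) * ((b + p) / 2) = 0) :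
    π (z b p q (n + 1)) + (((n : K) + 1) * ((b + p) / 2)) • (x₁ * π (z b p q n)) = 0 := by
  have rho_eq_zero : rho b p q (n + 1) = 0 := by
    rw [rho, Finset.prod_range_succ, h, mul_zero, mul_zero]
  have eval := congrArg (polyEval a b p q k) (zPoly_succ_add b p q n)
  rw [h, map_zero, zero_mul, sub_zero, map_add, C_mul', map_smul, map_mul, polyEval_zPoly,
    polyEval_zPoly, polyEval_X, polyEval_X] at eval
  exact eval.trans (proj_v_eq_zero rho_eq_zero)

omit [CharZero K] in
theorem skewDer_two_mul_x₁ (u : 𝔅) : ∂ 2 (u * x₁) = ∂ 2 u * x₁ := by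
  simp [IsBraiding.inducedSkewDer_mul, Fin.sum_univ_three, skewDer_x, braid_x₁]

omit [CharZero K] in
theorem skewDer_two_mul_x₃ (u : 𝔅) : ∂ 2 (u * x₃) = u + ∂ 2 u * (x₃ + p • x₁) := by
  simp [IsBraiding.inducedSkewDer_mul, Fin.sum_univ_three, skewDer_x, braid_x₃]

omit [CharZero K] in
theorem skewDer_two_pow_mul_x₃ (u : 𝔅) (n : ℕ) : (∂ 2 ^ (n + 1)) (u * x₃) =
    ((n : K) + 1) • (∂ 2 ^ n) u + (∂ 2 ^ (n + 1)) u * (x₃ + (((n : K) + 1) * p) • x₁) := by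
  induction n with
  | zero => simp [skewDer_two_mul_x₃]
  | succ n ih =>
    rw [pow_succ', Module.End.mul_apply, ih, map_add, map_smul, ← Module.End.mul_apply, ← pow_succ',
      mul_add, mul_smul_comm, map_add, map_smul, skewDer_two_mul_x₃, skewDer_two_mul_x₁,
      ← Module.End.mul_apply, ← pow_succ', mul_add, mul_add, mul_smul_comm, mul_smul_comm]
    push_cast
    module

theorem skewDer_two_pow_of_lt (f : MvPolynomial ℕ K) {j n : ℕ} (h : j < n) :
    (∂ 2 ^ n) (polyEval a b p q k f * x₃ ^ j) = 0 := by
  induction j generalizing n with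
  | zero =>
    obtain ⟨n, rfl⟩ := Nat.exists_eq_succ_of_ne_zero h.ne'
    rw [pow_zero, mul_one, pow_succ, Module.End.mul_apply, skewDer_two_polyEval, map_zero]
  | succ j ih =>
    obtain ⟨n, rfl⟩ := Nat.exists_eq_succ_of_ne_zero (Nat.ne_zero_of_lt h)
    rw [pow_succ x₃, ← mul_assoc, skewDer_two_pow_mul_x₃, ih (n := n) (by lia),
      ih (n := n + 1) (by lia), zero_mul, add_zero, smul_zero]

theorem skewDer_two_pow_self (f : MvPolynomial ℕ K) (j : ℕ) :
    (∂ 2 ^ j) (polyEval a b p q k f * x₃ ^ j) = (j.factorial : K) • polyEval a b p q k f := by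
  induction j with
  | zero => simp
  | succ j ih =>
    rw [pow_succ (M := 𝔅), ← mul_assoc, skewDer_two_pow_mul_x₃, ih,
      skewDer_two_pow_of_lt f j.lt_succ_self, zero_mul, add_zero, smul_smul, Nat.factorial_succ]
    push_cast
    rfl

theorem polyEval_eq_zero_of_sum {f : ℕ → MvPolynomial ℕ K} {d : ℕ}
    (h : ∑ j ∈ Finset.range d, polyEval a b p q k (f j) * x₃ ^ j = 0) :
    ∀ j < d, polyEval a b p q k (f j) = 0 := by
  induction d with
  | zero => intro j hj; lia
  | succ d ih =>
    have top : polyEval a b p q k (f d) = 0 := by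
      have der := congrArg (∂ 2 ^ d) h
      rw [map_sum, Finset.sum_range_succ, Finset.sum_eq_zero fun j hj =>
        skewDer_two_pow_of_lt (f j) (Finset.mem_range.1 hj), zero_add, skewDer_two_pow_self,
        map_zero] at der
      exact (smul_eq_zero.1 der).resolve_left (Nat.cast_ne_zero.2 d.factorial_ne_zero)
    rw [Finset.sum_range_succ, top, zero_mul, add_zero] at h
    intro j hj
    rcases Nat.lt_succ_iff_lt_or_eq.1 hj with hj | rfl
    exacts [ih h j hj, top]

theorem eq_zero_of_sum_polyEval_zSubst {N : ℕ} (hρ : ∀ n ≤ N, rho b p q n ≠ 0)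
    {f : ℕ → MvPolynomial ℕ K} (hf : ∀ j, f j ∈ supported K {i | i ≤ N + 1}) {d : ℕ}
    (h : ∑ j ∈ Finset.range d, polyEval a b p q k (zSubst b p q (f j)) * x₃ ^ j = 0) :
    ∀ j < d, f j = 0 := fun j hj =>
  (injective_iff_map_eq_zero _).1 (zSubst_injective b p q) _ <|
    eq_zero_of_polyEval_eq_zero hρ (zSubst_mem_supported b p q (hf j))
      (polyEval_eq_zero_of_sum h j hj)

end R12

section Spanning

variable {K : Type*} [CommRing K] {A : Type*} [Ring A] [Algebra K A] {σ : Type*}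

/-- The span of the values `φ m` of the monomials `m` of weight `d` in the variables from `s`. -/
def weightPart (φ : MvPolynomial σ K →ₐ[K] A) (w : σ → ℕ) (s : Set σ) (d : ℕ) : Submodule K A :=
  Submodule.span K {u | ∃ m ∈ Finsupp.supported ℕ ℕ s, Finsupp.weight w m = d ∧
    u = φ (MvPolynomial.monomial m 1)}

/-- The filtration of `A` by the spans of the elements `φ m * t ^ j`, with `m` a monomial of weight
at most `n - j` in the variables from `s`. -/
def filtration (φ : MvPolynomial σ K →ₐ[K] A) (w : σ → ℕ) (s : Set σ) (t : A) (n : ℕ) :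
    Submodule K A :=
  Submodule.span K {u | ∃ m ∈ Finsupp.supported ℕ ℕ s, ∃ j, Finsupp.weight w m + j ≤ n ∧
    u = φ (MvPolynomial.monomial m 1) * t ^ j}

variable {φ : MvPolynomial σ K →ₐ[K] A} {w : σ → ℕ} {s : Set σ} {t : A}

theorem monomial_mem_weightPart {m : σ →₀ ℕ} (hm : m ∈ Finsupp.supported ℕ ℕ s) :
    φ (MvPolynomial.monomial m 1) ∈ weightPart φ w s (Finsupp.weight w m) :=
  Submodule.subset_span ⟨m, hm, rfl, rfl⟩

theorem mul_mem_weightPart {d e : ℕ} {u v : A} (hu : u ∈ weightPart φ w s d)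
    (hv : v ∈ weightPart φ w s e) : u * v ∈ weightPart φ w s (d + e) := by
  have : weightPart φ w s d * weightPart φ w s e ≤ weightPart φ w s (d + e) := by
    rw [weightPart, weightPart, Submodule.span_mul_span, Submodule.span_le]
    rintro _ ⟨_, ⟨m, hm, rfl, rfl⟩, _, ⟨m', hm', rfl, rfl⟩, rfl⟩
    refine Submodule.subset_span ⟨m + m', add_mem hm hm', map_add _ _ _, ?_⟩
    simp only [← map_mul, MvPolynomial.monomial_mul, one_mul]
  exact this (Submodule.mul_mem_mul hu hv)

theorem X_mem_weightPart {i : σ} (hi : i ∈ s) : φ (MvPolynomial.X i) ∈ weightPart φ w s (w i) :=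
  Submodule.subset_span ⟨Finsupp.single i 1, Finsupp.single_mem_supported ℕ 1 hi,
    by simp [Finsupp.weight_single], rfl⟩

theorem one_mem_weightPart : (1 : A) ∈ weightPart φ w s 0 :=
  Submodule.subset_span ⟨0, zero_mem _, by simp, by simp⟩

theorem pow_mem_weightPart {d : ℕ} {u : A} (hu : u ∈ weightPart φ w s d) (n : ℕ) :
    u ^ n ∈ weightPart φ w s (n * d) := by
  induction n with
  | zero => rw [pow_zero, zero_mul]; exact one_mem_weightPart
  | succ n ih => rw [pow_succ, add_mul, one_mul]; exact mul_mem_weightPart ih hu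

theorem filtration_mono {m n : ℕ} (h : m ≤ n) : filtration φ w s t m ≤ filtration φ w s t n :=
  Submodule.span_mono fun _ ⟨e, he, j, hj, hu⟩ => ⟨e, he, j, hj.trans h, hu⟩

theorem monomial_mul_pow_mem_filtration {m : σ →₀ ℕ} (hm : m ∈ Finsupp.supported ℕ ℕ s) (j : ℕ) :
    φ (MvPolynomial.monomial m 1) * t ^ j ∈ filtration φ w s t (Finsupp.weight w m + j) :=
  Submodule.subset_span ⟨m, hm, j, le_rfl, rfl⟩

theorem pow_mem_filtration (j : ℕ) : t ^ j ∈ filtration φ w s t j :=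
  Submodule.subset_span ⟨0, zero_mem _, j, by simp, by simp⟩

theorem weightPart_mul_mem_filtration {d n : ℕ} {u v : A} (hu : u ∈ weightPart φ w s d)
    (hv : v ∈ filtration φ w s t n) : u * v ∈ filtration φ w s t (d + n) := by
  have : weightPart φ w s d * filtration φ w s t n ≤ filtration φ w s t (d + n) := by
    rw [weightPart, filtration, Submodule.span_mul_span, Submodule.span_le]
    rintro _ ⟨_, ⟨m, hm, rfl, rfl⟩, _, ⟨m', hm', j, hj, rfl⟩, rfl⟩
    refine Submodule.subset_span ⟨m + m', add_mem hm hm', j, by rw [map_add]; lia, ?_⟩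
    simp only [← mul_assoc, ← map_mul, MvPolynomial.monomial_mul, one_mul]
  exact this (Submodule.mul_mem_mul hu hv)

theorem lie_monomial_mem_weightPart
    (h : ∀ i ∈ s, ⁅t, φ (MvPolynomial.X i)⁆ ∈ weightPart φ w s (w i + 1))
    {m : σ →₀ ℕ} (hm : m ∈ Finsupp.supported ℕ ℕ s) :
    ⁅t, φ (MvPolynomial.monomial m 1)⁆ ∈ weightPart φ w s (Finsupp.weight w m + 1) := by
  have supported_eq (m : σ →₀ ℕ) : m ∈ Finsupp.supported ℕ ℕ s ↔
      m ∈ AddSubmonoid.closure ((Finsupp.single · 1) '' s) := by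
    rw [← Submodule.span_nat_eq_addSubmonoidClosure, Submodule.mem_toAddSubmonoid,
      Finsupp.supported_eq_span_single]
  rw [supported_eq] at hm
  induction hm using AddSubmonoid.closure_induction with
  | mem m hm =>
    obtain ⟨i, hi, rfl⟩ := hm
    rw [Finsupp.weight_single, smul_eq_mul, one_mul]
    exact h i hi
  | zero => simp [Ring.lie_def]
  | add m m' hm hm' ih ih' =>
    have leibniz : ⁅t, φ (MvPolynomial.monomial (m + m') 1)⁆ =
        ⁅t, φ (MvPolynomial.monomial m 1)⁆ * φ (MvPolynomial.monomial m' 1) +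
          φ (MvPolynomial.monomial m 1) * ⁅t, φ (MvPolynomial.monomial m' 1)⁆ := by
      rw [← one_mul (1 : K), ← MvPolynomial.monomial_mul, map_mul]
      simp only [Ring.lie_def, one_mul]
      noncomm_ring
    rw [leibniz, map_add]
    refine add_mem ?_ ?_
    · rw [add_right_comm]
      exact mul_mem_weightPart ih (monomial_mem_weightPart ((supported_eq m').2 hm'))
    · rw [add_assoc]
      exact mul_mem_weightPart (monomial_mem_weightPart ((supported_eq m).2 hm)) ih'

theorem mul_mem_filtration
    (h : ∀ i ∈ s, ⁅t, φ (MvPolynomial.X i)⁆ ∈ weightPart φ w s (w i + 1))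
    {n : ℕ} {u : A} (hu : u ∈ filtration φ w s t n) : t * u ∈ filtration φ w s t (n + 1) := by
  suffices filtration φ w s t n ≤ (filtration φ w s t (n + 1)).comap (LinearMap.mulLeft K t) from
    this hu
  refine Submodule.span_le.2 ?_
  rintro _ ⟨m, hm, j, hj, rfl⟩
  have swap : t * (φ (MvPolynomial.monomial m 1) * t ^ j) =
      φ (MvPolynomial.monomial m 1) * t ^ (j + 1) + ⁅t, φ (MvPolynomial.monomial m 1)⁆ * t ^ j := by
    rw [Ring.lie_def, pow_succ']
    noncomm_ring
  rw [SetLike.mem_coe, Submodule.mem_comap, LinearMap.mulLeft_apply, swap]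
  exact add_mem (filtration_mono (by lia) (monomial_mul_pow_mem_filtration hm (j + 1)))
    (filtration_mono (by lia) (weightPart_mul_mem_filtration (lie_monomial_mem_weightPart h hm)
      (pow_mem_filtration j)))

theorem exists_mem_pow_span_generators {ι : Type*} (π : FreeAlgebra K ι →ₐ[K] A)
    (y : FreeAlgebra K ι) :
    ∃ n, π y ∈ (1 ⊔ Submodule.span K (Set.range fun i => π (FreeAlgebra.ι K i))) ^ n := by
  set V : Submodule K A := 1 ⊔ Submodule.span K (Set.range fun i => π (FreeAlgebra.ι K i))
  have mono {m n : ℕ} (hmn : m ≤ n) : V ^ m ≤ V ^ n := pow_le_pow_right' le_sup_left hmn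
  induction y using freeAlgebra_induction_left with
  | one => exact ⟨0, by rw [map_one, pow_zero]; exact Submodule.one_le.1 le_rfl⟩
  | ι_mul i y ih =>
    obtain ⟨n, hn⟩ := ih
    refine ⟨n + 1, ?_⟩
    rw [map_mul, pow_succ']
    exact Submodule.mul_mem_mul (Submodule.mem_sup_right (Submodule.subset_span ⟨i, rfl⟩)) hn
  | add y z hy hz =>
    obtain ⟨m, hm⟩ := hy
    obtain ⟨n, hn⟩ := hz
    refine ⟨max m n, ?_⟩
    rw [map_add]
    exact add_mem (mono (le_max_left _ _) hm) (mono (le_max_right _ _) hn)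
  | smul c y hy =>
    obtain ⟨n, hn⟩ := hy
    exact ⟨n, by rw [map_smul]; exact Submodule.smul_mem _ _ hn⟩

end Spanning

section Commutation

variable {K : Type*} [Field K] {A : Type*} [Ring A] [Algebra K A] {b p q : K}
  {π : FreeAlgebra K (Fin 3) →ₐ[K] A}

theorem map_z_succ (n : ℕ) : π (z b p q (n + 1)) =
    ⁅π (x K 2), π (z b p q n)⁆ - (((n : K) + 1) * b) • (π (x K 0) * π (z b p q n)) +
      ((n.factorial : K) * (q - p) * ((-b - p) / 2) ^ n) •
        (π (x K 0) ^ (n + 1) * π (z b p q 0)) := by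
  rw [z.eq_2, Ring.lie_def]
  simp only [map_add, map_sub, map_mul, map_smul, map_pow, sub_mul, smul_mul_assoc]
  rw [sub_right_comm]
  rfl

theorem lie_x₃_x₁ (h : ∀ u ∈ quadraticRels b p, π u = 0) :
    ⁅π (x K 2), π (x K 0)⁆ = (-((p - b) / 2)) • π (x K 0) ^ 2 := by
  have rel := h _ (Set.mem_insert_of_mem _ rfl)
  rw [map_add, map_sub, map_mul, map_mul, map_smul, map_pow] at rel
  rw [Ring.lie_def, neg_smul, eq_neg_of_add_eq_zero_left rel]

theorem commute_x₁_z (h : ∀ u ∈ quadraticRels b p, π u = 0) (n : ℕ) :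
    Commute (π (x K 0)) (π (z b p q n)) := by
  have base : Commute (π (x K 0)) (π (z b p q 0)) := by
    have rel := h _ (Set.mem_insert _ _)
    rw [map_sub, map_mul, map_mul, sub_eq_zero] at rel
    exact rel.symm
  induction n with
  | zero => exact base
  | succ n ih =>
    have bracket : Commute ⁅π (x K 2), π (z b p q n)⁆ (π (x K 0)) := by
      rw [commute_iff_lie_eq, lie_lie_comm ih.symm, ← commute_iff_lie_eq, lie_x₃_x₁ h]
      exact (ih.pow_left 2).smul_left _
    rw [map_z_succ]
    exact (bracket.symm.sub_right (((Commute.refl _).mul_right ih).smul_right _)).add_right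
      ((((Commute.refl _).pow_right _).mul_right base).smul_right _)

/- Up to elements that commute with `z_j`, the element `z_{i+1}` is `⁅x_3, z_i⁆`. -/
theorem lie_z_succ_z (h : ∀ u ∈ quadraticRels b p, π u = 0) {i j : ℕ}
    (comm_zero : Commute (π (z b p q 0)) (π (z b p q j)))
    (comm : Commute (π (z b p q i)) (π (z b p q j))) :
    ⁅π (z b p q (i + 1)), π (z b p q j)⁆ = ⁅⁅π (x K 2), π (z b p q i)⁆, π (z b p q j)⁆ := by
  have comm_x₁ := commute_x₁_z (q := q) h j
  have tail : Commute
      ((((i : K) + 1) * b) • (π (x K 0) * π (z b p q i)) -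
        ((i.factorial : K) * (q - p) * ((-b - p) / 2) ^ i) •
          (π (x K 0) ^ (i + 1) * π (z b p q 0))) (π (z b p q j)) :=
    ((comm_x₁.mul_left comm).smul_left _).sub_left
      (((comm_x₁.pow_left _).mul_left comm_zero).smul_left _)
  rw [map_z_succ, sub_add, Ring.lie_def, sub_mul, mul_sub (π (z b p q j)), tail.eq,
    sub_sub_sub_cancel_right]
  rfl

theorem commute_z_of_add_eq (h : ∀ u ∈ quadraticRels b p, π u = 0)
    (hz : ∀ u ∈ zRels b p q, π u = 0) {d : ℕ}
    (lower : ∀ i j, i + j < d → Commute (π (z b p q i)) (π (z b p q j))) (e j : ℕ)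
    (hj : j + e + j = d) : Commute (π (z b p q (j + e))) (π (z b p q j)) := by
  induction e using Nat.twoStepInduction generalizing j with
  | zero => exact Commute.refl _
  | one =>
    have rel := hz _ ⟨j, rfl⟩
    rwa [map_sub, map_mul, map_mul, sub_eq_zero] at rel
  | more e ih _ =>
    have comm := lower (j + e + 1) j (by lia)
    have inner := (ih (j + 1) (by lia)).symm
    rw [show j + 1 + e = j + e + 1 by lia, commute_iff_lie_eq,
      lie_z_succ_z h (lower 0 _ (by lia)) comm.symm] at inner
    rw [commute_iff_lie_eq, show j + (e + 2) = j + e + 1 + 1 by lia,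
      lie_z_succ_z h (lower 0 _ (by lia)) comm, lie_lie_comm comm, inner]

theorem commute_z_z (h : ∀ u ∈ quadraticRels b p, π u = 0) (hz : ∀ u ∈ zRels b p q, π u = 0)
    (i j : ℕ) : Commute (π (z b p q i)) (π (z b p q j)) := by
  induction hd : i + j using Nat.strong_induction_on generalizing i j with
  | _ d ih =>
    have lower (i j : ℕ) (hij : i + j < d) := ih _ hij i j rfl
    rcases le_total j i with hle | hle
    · obtain ⟨e, rfl⟩ := Nat.exists_eq_add_of_le hle
      exact commute_z_of_add_eq h hz lower e j hd
    · obtain ⟨e, rfl⟩ := Nat.exists_eq_add_of_le hle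
      exact (commute_z_of_add_eq h hz lower e i (by lia)).symm

end Commutation

section NormalForm

variable {K : Type*} [Field K] {A : Type*} [Ring A] [Algebra K A] {b p q : K}
  {π : FreeAlgebra K (Fin 3) →ₐ[K] A}

/-- The family `x_1, z_0, z_1, …`. -/
def zFamily (b p q : K) : ℕ → FreeAlgebra K (Fin 3)
  | 0 => x K 0
  | n + 1 => z b p q n

/-- The degrees of `x_1, z_0, z_1, …`. -/
def zWeight : ℕ → ℕ
  | 0 => 1
  | n + 1 => n + 1

theorem zWeight_ne_zero (i : ℕ) : zWeight i ≠ 0 := by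
  cases i <;> simp [zWeight]

theorem commute_zFamily (h : ∀ u ∈ quadraticRels b p, π u = 0) (hz : ∀ u ∈ zRels b p q, π u = 0)
    (i j : ℕ) : Commute (π (zFamily b p q i)) (π (zFamily b p q j)) := by
  cases i <;> cases j
  · exact Commute.refl _
  · exact commute_x₁_z h _
  · exact (commute_x₁_z h _).symm
  · exact commute_z_z h hz _ _

/-- The evaluation of polynomials at `x_1, z_0, z_1, …` in an algebra where the relations (1) and
(2) hold. -/
def zEval (h : ∀ u ∈ quadraticRels b p, π u = 0) (hz : ∀ u ∈ zRels b p q, π u = 0) :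
    MvPolynomial ℕ K →ₐ[K] A :=
  commAeval (fun i => π (zFamily b p q i)) (commute_zFamily h hz)

variable (h : ∀ u ∈ quadraticRels b p, π u = 0) (hz : ∀ u ∈ zRels b p q, π u = 0)

theorem zEval_X (i : ℕ) : zEval h hz (MvPolynomial.X i) = π (zFamily b p q i) :=
  commAeval_X _ _ i

variable {s : Set ℕ}

theorem zFamily_mem_weightPart {i : ℕ} (hi : i ∈ s) :
    π (zFamily b p q i) ∈ weightPart (zEval h hz) zWeight s (zWeight i) := by
  rw [← zEval_X h hz]
  exact X_mem_weightPart hi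

theorem x₁_mem_weightPart (h₀ : 0 ∈ s) : π (x K 0) ∈ weightPart (zEval h hz) zWeight s 1 := by
  simpa only [zFamily, zWeight] using zFamily_mem_weightPart h hz h₀

theorem z_mem_weightPart {n : ℕ} (hn : n + 1 ∈ s) :
    π (z b p q n) ∈ weightPart (zEval h hz) zWeight s (n + 1) := by
  simpa only [zFamily, zWeight] using zFamily_mem_weightPart h hz hn

variable (h₀ : 0 ∈ s) (h₁ : 1 ∈ s)
  (hs : ∀ n, n + 1 ∈ s → π (z b p q (n + 1)) ∈ weightPart (zEval h hz) zWeight s (n + 2))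
include h₀ h₁ hs

theorem lie_x₃_X_mem_weightPart {i : ℕ} (hi : i ∈ s) :
    ⁅π (x K 2), zEval h hz (MvPolynomial.X i)⁆ ∈
      weightPart (zEval h hz) zWeight s (zWeight i + 1) := by
  have x₁_mem := x₁_mem_weightPart h hz h₀
  rw [zEval_X]
  cases i with
  | zero =>
    rw [zFamily, lie_x₃_x₁ h]
    exact Submodule.smul_mem _ _ (pow_mem_weightPart x₁_mem 2)
  | succ n =>
    have bracket := map_z_succ (π := π) (b := b) (p := p) (q := q) n
    rw [← sub_eq_iff_eq_add, eq_sub_iff_add_eq] at bracket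
    rw [zFamily, zWeight, ← bracket]
    refine add_mem (sub_mem (hs n hi) (Submodule.smul_mem _ _ ?_)) (Submodule.smul_mem _ _ ?_)
    · simpa only [mul_one, zero_add] using
        mul_mem_weightPart (pow_mem_weightPart x₁_mem (n + 1)) (z_mem_weightPart h hz h₁)
    · simpa only [add_comm 1] using mul_mem_weightPart x₁_mem (z_mem_weightPart h hz hi)

theorem generator_mul_mem_filtration (i : Fin 3) {n : ℕ} {u : A}
    (hu : u ∈ filtration (zEval h hz) zWeight s (π (x K 2)) n) :
    π (x K i) * u ∈ filtration (zEval h hz) zWeight s (π (x K 2)) (n + 1) := by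
  match i with
  | 0 =>
    rw [add_comm n 1]
    exact weightPart_mul_mem_filtration (x₁_mem_weightPart h hz h₀) hu
  | 1 =>
    rw [add_comm n 1]
    exact weightPart_mul_mem_filtration (z_mem_weightPart h hz h₁) hu
  | 2 => exact mul_mem_filtration (fun _ hi => lie_x₃_X_mem_weightPart h hz h₀ h₁ hs hi) hu

theorem pow_le_filtration (n : ℕ) :
    (1 ⊔ Submodule.span K (Set.range fun i => π (x K i))) ^ n ≤
      filtration (zEval h hz) zWeight s (π (x K 2)) n := by
  induction n with
  | zero =>
    rw [pow_zero, Submodule.one_le, ← pow_zero (π (x K 2))]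
    exact pow_mem_filtration 0
  | succ n ih =>
    rw [pow_succ', Submodule.sup_mul, one_mul]
    refine sup_le (ih.trans (filtration_mono (Nat.le_succ n))) ?_
    rw [Submodule.mul_le]
    intro u hu v hv
    suffices Submodule.span K (Set.range fun i => π (x K i)) ≤
        (filtration (zEval h hz) zWeight s (π (x K 2)) (n + 1)).comap (LinearMap.mulRight K v) from
      this hu
    refine Submodule.span_le.2 ?_
    rintro _ ⟨i, rfl⟩
    exact generator_mul_mem_filtration h hz h₀ h₁ hs i (ih hv)

theorem mem_span_normalForm {τ : Type*} (f : τ → (ℕ →₀ ℕ) × ℕ)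
    (hf : ∀ m ∈ Finsupp.supported ℕ ℕ s, ∀ j, ∃ i, f i = (m, j)) (y : FreeAlgebra K (Fin 3)) :
    π y ∈ Submodule.span K (Set.range fun i =>
      zEval h hz (MvPolynomial.monomial (f i).1 1) * π (x K 2) ^ (f i).2) := by
  obtain ⟨n, hn⟩ := exists_mem_pow_span_generators π y
  refine Submodule.span_mono ?_ (pow_le_filtration h hz h₀ h₁ hs n hn)
  rintro _ ⟨m, hm, j, -, rfl⟩
  obtain ⟨i, hi⟩ := hf m hm j
  exact ⟨i, by simp only [hi]⟩

end NormalForm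

section Exponents

/-- The exponent of the monomial `X_0 ^ a₁ * X_1 ^ a₂ * X_2 ^ e 0 * ⋯ * X_{n+1} ^ e (n - 1)`. -/
def exponent {n : ℕ} (a₁ a₂ : ℕ) (e : Fin n → ℕ) : ℕ →₀ ℕ :=
  Finsupp.single 0 a₁ + Finsupp.single 1 a₂ + ∑ j : Fin n, Finsupp.single ((j : ℕ) + 2) (e j)

variable {n : ℕ} (a₁ a₂ : ℕ) (e : Fin n → ℕ)

theorem exponent_zero : exponent a₁ a₂ e 0 = a₁ := by
  simp [exponent]

theorem exponent_one : exponent a₁ a₂ e 1 = a₂ := by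
  simp [exponent]

theorem exponent_add_two (j : Fin n) : exponent a₁ a₂ e ((j : ℕ) + 2) = e j := by
  simp [exponent, Finsupp.single_apply, Fin.val_inj]

theorem exponent_of_le {j : ℕ} (hj : n ≤ j) : exponent a₁ a₂ e (j + 2) = 0 := by
  have ne (i : Fin n) : (i : ℕ) ≠ j := (i.2.trans_le hj).ne
  simp [exponent, ne]

theorem exponent_mem_supported : exponent a₁ a₂ e ∈ Finsupp.supported ℕ ℕ {i | i ≤ n + 1} := by
  rw [Finsupp.mem_supported']
  intro i hi
  obtain ⟨j, rfl⟩ : ∃ j, i = j + 2 := ⟨i - 2, by grind⟩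
  exact exponent_of_le a₁ a₂ e (by grind)

theorem exponent_eq_of_mem_supported {m : ℕ →₀ ℕ}
    (h : m ∈ Finsupp.supported ℕ ℕ {i | i ≤ n + 1}) :
    exponent (m 0) (m 1) (fun j : Fin n => m (j + 2)) = m := by
  ext i
  rcases i with _ | _ | j
  · rw [exponent_zero]
  · rw [exponent_one]
  · by_cases hj : j < n
    · exact exponent_add_two (m 0) (m 1) (fun j : Fin n => m (j + 2)) ⟨j, hj⟩
    · rw [exponent_of_le _ _ _ (not_lt.1 hj), (Finsupp.mem_supported' _ _).1 h]
      grind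

/-- The pair of the exponent of `x_1, z_0, z_1, …` and the exponent of `x_3` in `BFin b p q n s`. -/
def exponentFin (n : ℕ) (s : ℕ × ℕ × (Fin n → ℕ) × ℕ) : (ℕ →₀ ℕ) × ℕ :=
  (exponent s.1 s.2.1 s.2.2.1, s.2.2.2)

theorem exponentFin_injective (n : ℕ) : Function.Injective (exponentFin n) := by
  rintro ⟨a₁, a₂, e, a₃⟩ ⟨a₁', a₂', e', a₃'⟩ h
  obtain ⟨heq, h₃ : a₃ = a₃'⟩ := Prod.ext_iff.1 h
  have apply_eq := DFunLike.congr_fun heq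
  have h₁ : a₁ = a₁' := by simpa only [exponentFin, exponent_zero] using apply_eq 0
  have h₂ : a₂ = a₂' := by simpa only [exponentFin, exponent_one] using apply_eq 1
  have he : e = e' := funext fun j => by
    simpa only [exponentFin, exponent_add_two] using apply_eq (j + 2)
  rw [h₁, h₂, he, h₃]

theorem exists_exponentFin_eq {m : ℕ →₀ ℕ} (h : m ∈ Finsupp.supported ℕ ℕ {i | i ≤ n + 1})
    (j : ℕ) : ∃ s, exponentFin n s = (m, j) :=
  ⟨(m 0, m 1, fun i => m (i + 2), j), by rw [exponentFin, exponent_eq_of_mem_supported h]⟩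

/-- The pair of the exponent of `x_1, z_0, z_1, …` and the exponent of `x_3` in `BInfty b p q s`. -/
def exponentInfty (s : ℕ × ℕ × (ℕ →₀ ℕ) × ℕ) : (ℕ →₀ ℕ) × ℕ :=
  (exponent s.1 s.2.1 fun j : Fin (s.2.2.1.support.sup Nat.succ) => s.2.2.1 j, s.2.2.2)

theorem exponentInfty_add_two (s : ℕ × ℕ × (ℕ →₀ ℕ) × ℕ) (j : ℕ) :
    (exponentInfty s).1 (j + 2) = s.2.2.1 j := by
  by_cases hj : j < s.2.2.1.support.sup Nat.succ
  · exact exponent_add_two s.1 s.2.1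
      (fun j : Fin (s.2.2.1.support.sup Nat.succ) => s.2.2.1 j) ⟨j, hj⟩
  · have not_mem : j ∉ s.2.2.1.support := fun h => hj (Finset.le_sup (f := Nat.succ) h)
    rw [exponentInfty, exponent_of_le _ _ _ (not_lt.1 hj), Finsupp.notMem_support_iff.1 not_mem]

theorem exponentInfty_injective : Function.Injective exponentInfty := by
  rintro ⟨a₁, a₂, e, a₃⟩ ⟨a₁', a₂', e', a₃'⟩ h
  obtain ⟨heq, h₃ : a₃ = a₃'⟩ := Prod.ext_iff.1 h
  have apply_eq := DFunLike.congr_fun heq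
  have h₁ : a₁ = a₁' := by simpa only [exponentInfty, exponent_zero] using apply_eq 0
  have h₂ : a₂ = a₂' := by simpa only [exponentInfty, exponent_one] using apply_eq 1
  have he : e = e' := Finsupp.ext fun j => by
    simpa only [exponentInfty_add_two] using apply_eq (j + 2)
  rw [h₁, h₂, he, h₃]

theorem exists_exponentInfty_eq (m : ℕ →₀ ℕ) (j : ℕ) : ∃ s, exponentInfty s = (m, j) := by
  refine ⟨(m 0, m 1, m.comapDomain (· + 2) (add_left_injective 2).injOn, j),
    Prod.ext (Finsupp.ext fun i => ?_) rfl⟩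
  rcases i with _ | _ | i
  · rw [exponentInfty, exponent_zero]
  · rw [exponentInfty, exponent_one]
  · rw [exponentInfty_add_two, Finsupp.comapDomain_apply]

theorem X_pow_mul_prod_eq_monomial (R : Type*) [CommSemiring R] :
    MvPolynomial.X 0 ^ a₁ * MvPolynomial.X 1 ^ a₂ *
        (List.ofFn fun j : Fin n => (MvPolynomial.X ((j : ℕ) + 2) : MvPolynomial ℕ R) ^ e j).prod =
      MvPolynomial.monomial (exponent a₁ a₂ e) 1 := by
  rw [List.prod_ofFn]
  simp only [MvPolynomial.X_pow_eq_monomial]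
  rw [← MvPolynomial.monomial_sum_one, MvPolynomial.monomial_mul, MvPolynomial.monomial_mul,
    one_mul, one_mul, exponent]

variable {K : Type*} [Field K] {A : Type*} [Ring A] [Algebra K A] {b p q : K}
  {π : FreeAlgebra K (Fin 3) →ₐ[K] A}
  (h : ∀ u ∈ quadraticRels b p, π u = 0) (hz : ∀ u ∈ zRels b p q, π u = 0)

theorem map_monomial (a₃ : ℕ) : π (monomial b p q a₁ a₂ e a₃) =
    zEval h hz (MvPolynomial.monomial (exponent a₁ a₂ e) 1) * π (x K 2) ^ a₃ := by
  rw [← X_pow_mul_prod_eq_monomial, monomial]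
  simp only [map_mul, map_pow, map_list_prod, List.map_ofFn, Function.comp_def, zEval_X]
  rfl

theorem map_BFin (s : ℕ × ℕ × (Fin n → ℕ) × ℕ) : π (BFin b p q n s) =
    zEval h hz (MvPolynomial.monomial (exponentFin n s).1 1) * π (x K 2) ^ (exponentFin n s).2 :=
  map_monomial _ _ _ h hz _

theorem map_BInfty (s : ℕ × ℕ × (ℕ →₀ ℕ) × ℕ) : π (BInfty b p q s) =
    zEval h hz (MvPolynomial.monomial (exponentInfty s).1 1) * π (x K 2) ^ (exponentInfty s).2 :=
  map_monomial _ _ _ h hz _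

end Exponents

section Independence

variable {K : Type*} [Field K] [CharZero K] {a b p q k : K}

local notation "π" => proj (R12 1 a b p q k)
local notation "x₃" => proj (R12 1 a b p q k) (x K 2)

open MvPolynomial in
theorem linearIndepOn_monomial_mul_pow {N : ℕ} (hρ : ∀ n ≤ N, rho b p q n ≠ 0) :
    LinearIndepOn K (fun m : (ℕ →₀ ℕ) × ℕ =>
      polyEval a b p q k (zSubst b p q (MvPolynomial.monomial m.1 1)) * x₃ ^ m.2)
      {m | m.1 ∈ Finsupp.supported ℕ ℕ {i | i ≤ N + 1}} := by
  classical
  rw [linearIndepOn_iff]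
  intro l hl h
  let exps := l.support.image Prod.fst
  let d := l.support.sup Prod.snd + 1
  let f (j : ℕ) : MvPolynomial ℕ K := ∑ m ∈ exps, l (m, j) • MvPolynomial.monomial m 1
  have coeff_f (m : ℕ →₀ ℕ) (j : ℕ) : coeff m (f j) = l (m, j) := by
    simp only [f, coeff_sum, coeff_smul, coeff_monomial, smul_eq_mul, mul_ite, mul_one, mul_zero,
      Finset.sum_ite_eq']
    refine ite_eq_left_iff.2 fun hm => ?_
    by_contra hne
    exact hm (Finset.mem_image_of_mem Prod.fst (Finsupp.mem_support_iff.2 (Ne.symm hne)))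
  have f_mem (j : ℕ) : f j ∈ supported K {i | i ≤ N + 1} := by
    refine Subalgebra.sum_mem _ fun m hm => Subalgebra.smul_mem _ ?_ _
    obtain ⟨m, hml, rfl⟩ := Finset.mem_image.1 hm
    rw [mem_supported, vars_monomial one_ne_zero]
    exact hl hml
  have lt_d {m : (ℕ →₀ ℕ) × ℕ} (hm : m ∈ l.support) : m.2 < d :=
    Nat.lt_succ_of_le (Finset.le_sup (f := Prod.snd) hm)
  have sum_eq_zero :
      ∑ j ∈ Finset.range d, polyEval a b p q k (zSubst b p q (f j)) * x₃ ^ j = 0 := by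
    have support_le : l.support ⊆ exps ×ˢ Finset.range d := fun m hm =>
      Finset.mem_product.2 ⟨Finset.mem_image_of_mem _ hm, Finset.mem_range.2 (lt_d hm)⟩
    rw [Finsupp.linearCombination_apply,
      Finsupp.sum_of_support_subset l support_le, Finset.sum_product_right] at h
    · simpa only [f, map_sum, map_smul, Finset.sum_mul, smul_mul_assoc] using h
    · exact fun _ _ => zero_smul K _
  ext ⟨m, j⟩
  by_contra hne
  refine hne ?_
  rw [← coeff_f, eq_zero_of_sum_polyEval_zSubst hρ f_mem sum_eq_zero j
    (lt_d (Finsupp.mem_support_iff.2 hne)), coeff_zero, Finsupp.coe_zero, Pi.zero_apply]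

theorem linearIndependent_monomial_mul_pow (hρ : ∀ n, rho b p q n ≠ 0) :
    LinearIndependent K fun m : (ℕ →₀ ℕ) × ℕ =>
      polyEval a b p q k (zSubst b p q (MvPolynomial.monomial m.1 1)) * x₃ ^ m.2 := by
  have mono : Monotone fun N : ℕ =>
      {m : (ℕ →₀ ℕ) × ℕ | m.1 ∈ Finsupp.supported ℕ ℕ {i | i ≤ N + 1}} := fun M N hMN _ hm _ hi =>
    (hm hi).trans (Nat.succ_le_succ hMN)
  have exhausts : ⋃ N, {m : (ℕ →₀ ℕ) × ℕ | m.1 ∈ Finsupp.supported ℕ ℕ {i | i ≤ N + 1}} =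
      Set.univ := by
    refine Set.eq_univ_of_forall fun m => Set.mem_iUnion.2 ⟨m.1.support.sup id, ?_⟩
    exact fun i hi => (Finset.le_sup (f := id) hi).trans (Nat.le_succ _)
  rw [← linearIndepOn_univ_iff, ← exhausts]
  exact linearIndepOn_iUnion_of_directed mono.directed_le fun N =>
    linearIndepOn_monomial_mul_pow fun n _ => hρ n

variable (a b p q k)

theorem proj_quadraticRels {u : FreeAlgebra K (Fin 3)} (hu : u ∈ quadraticRels b p) : π u = 0 := by
  rcases hu with rfl | rfl
  · rw [map_sub, map_mul, map_mul, sub_eq_zero]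
    exact (commute_x₁_v 0).eq.symm
  · rw [map_add, map_sub, map_mul, map_mul, map_smul, map_pow, x₃_mul_x₁, add_sub_cancel_left,
      ← add_smul, ← add_div, sub_add_sub_cancel', sub_self, zero_div, zero_smul]

theorem proj_zRels {u : FreeAlgebra K (Fin 3)} (hu : u ∈ zRels b p q) : π u = 0 := by
  obtain ⟨n, rfl⟩ := hu
  rw [map_sub, map_mul, map_mul, (commute_proj_z _ _).eq, sub_self]

theorem zEval_proj :
    zEval (fun _ => proj_quadraticRels a b p q k) (fun _ => proj_zRels a b p q k) =
      (polyEval a b p q k).comp (zSubst b p q) := by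
  ext i
  rw [zEval_X, AlgHom.comp_apply]
  cases i with
  | zero => rw [zSubst_X_zero, polyEval_X]; rfl
  | succ n => rw [zSubst_X_succ, polyEval_zPoly]; rfl

variable {a b p q k}

theorem linearIndependent_BFin {N : ℕ} (hρ : ∀ n ≤ N, rho b p q n ≠ 0) :
    LinearIndependent K fun s => π (BFin b p q N s) := by
  simp only [map_BFin (fun _ => proj_quadraticRels a b p q k) (fun _ => proj_zRels a b p q k),
    zEval_proj]
  exact (linearIndepOn_monomial_mul_pow hρ).comp
    (fun s => ⟨exponentFin N s, exponent_mem_supported _ _ _⟩)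
    fun _ _ h => exponentFin_injective N (congrArg Subtype.val h)

theorem linearIndependent_BInfty (hρ : ∀ n, rho b p q n ≠ 0) :
    LinearIndependent K fun s => π (BInfty b p q s) := by
  simp only [map_BInfty (fun _ => proj_quadraticRels a b p q k) (fun _ => proj_zRels a b p q k),
    zEval_proj]
  exact (linearIndependent_monomial_mul_pow hρ).comp _ exponentInfty_injective

end Independence

section Presentation

variable {K : Type*} [Field K] {A : Type*} [Ring A] [Algebra K A] {I J : TwoSidedIdeal A}
  {τ : Type*} {f : τ → A}

theorem exists_sub_linearCombination_mem {y : A}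
    (h : I.ringCon.mkₐ (α := K) y ∈
      Submodule.span K (Set.range fun s => I.ringCon.mkₐ (α := K) (f s))) :
    ∃ c, y - Finsupp.linearCombination K f c ∈ I := by
  obtain ⟨c, hc⟩ := Finsupp.mem_span_range_iff_exists_finsupp.1 h
  refine ⟨c, mk_eq_zero_iff (K := K).1 ?_⟩
  rw [map_sub, ← hc, Finsupp.linearCombination_apply, map_finsuppSum]
  simp only [map_smul, sub_self]

theorem eq_and_isBasis_of_le (le : I ≤ J)
    (indep : LinearIndependent K fun s => J.ringCon.mkₐ (α := K) (f s))
    (span : ∀ y, I.ringCon.mkₐ (α := K) y ∈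
      Submodule.span K (Set.range fun s => I.ringCon.mkₐ (α := K) (f s))) :
    J = I ∧ IsBasis K fun s => J.ringCon.mkₐ (α := K) (f s) := by
  have mk_eq {y : A} {c : τ →₀ K} (hc : y - Finsupp.linearCombination K f c ∈ I) :
      J.ringCon.mkₐ (α := K) y =
        Finsupp.linearCombination K (fun s => J.ringCon.mkₐ (α := K) (f s)) c := by
    have proj_sub := mk_eq_zero_iff (K := K).2 (le hc)
    rw [map_sub, sub_eq_zero] at proj_sub
    rw [proj_sub, Finsupp.linearCombination_apply, map_finsuppSum,
      Finsupp.linearCombination_apply]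
    simp only [map_smul]
  refine ⟨le_antisymm (fun y hy => ?_) le, indep, eq_top_iff.2 fun u _ => ?_⟩
  · obtain ⟨c, hc⟩ := exists_sub_linearCombination_mem (span y)
    have c_eq_zero : c = 0 :=
      linearIndependent_iff.1 indep c ((mk_eq hc).symm.trans (mk_eq_zero_iff.2 hy))
    rwa [c_eq_zero, map_zero, sub_zero] at hc
  · obtain ⟨y, rfl⟩ := RingCon.mkₐ_surjective (α := K) J.ringCon u
    obtain ⟨c, hc⟩ := exists_sub_linearCombination_mem (span y)
    exact Finsupp.mem_span_range_iff_exists_finsupp.2 ⟨c, (mk_eq hc).symm⟩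

variable {b p q : K} {π : FreeAlgebra K (Fin 3) →ₐ[K] A}

theorem z_succ_mem_weightPart (h : ∀ u ∈ quadraticRels b p, π u = 0)
    (hz : ∀ u ∈ zRels b p q, π u = 0) {N : ℕ}
    (hN : π (z b p q (N + 1) + (((N : K) + 1) * ((b + p) / 2)) • (x K 0 * z b p q N)) = 0)
    (n : ℕ) (hn : n + 1 ∈ {i | i ≤ N + 1}) :
    π (z b p q (n + 1)) ∈ weightPart (zEval h hz) zWeight {i | i ≤ N + 1} (n + 2) := by
  obtain hlt | rfl := (Nat.le_of_succ_le_succ hn).lt_or_eq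
  · exact z_mem_weightPart h hz (Nat.succ_le_succ hlt)
  · rw [map_add, map_smul, map_mul, add_eq_zero_iff_eq_neg] at hN
    have mul_mem : π (x K 0) * π (z b p q n) ∈
        weightPart (zEval h hz) zWeight {i | i ≤ n + 1} (1 + (n + 1)) :=
      mul_mem_weightPart (x₁_mem_weightPart h hz (Nat.zero_le _)) (z_mem_weightPart h hz hn)
    rw [Nat.add_comm 1] at mul_mem
    exact hN ▸ neg_mem (Submodule.smul_mem _ _ mul_mem)

theorem mem_span_BInfty (h : ∀ u ∈ quadraticRels b p, π u = 0)
    (hz : ∀ u ∈ zRels b p q, π u = 0) (y : FreeAlgebra K (Fin 3)) :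
    π y ∈ Submodule.span K (Set.range fun s => π (BInfty b p q s)) := by
  simp only [map_BInfty h hz]
  exact mem_span_normalForm h hz (Set.mem_univ 0) (Set.mem_univ 1)
    (fun n _ => z_mem_weightPart h hz (Set.mem_univ (n + 2))) _
    (fun m _ j => exists_exponentInfty_eq m j) y

theorem mem_span_BFin (h : ∀ u ∈ quadraticRels b p, π u = 0)
    (hz : ∀ u ∈ zRels b p q, π u = 0) {N : ℕ}
    (hN : π (z b p q (N + 1) + (((N : K) + 1) * ((b + p) / 2)) • (x K 0 * z b p q N)) = 0)
    (y : FreeAlgebra K (Fin 3)) :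
    π y ∈ Submodule.span K (Set.range fun s => π (BFin b p q N s)) := by
  simp only [map_BFin h hz]
  exact mem_span_normalForm (s := {i | i ≤ N + 1}) h hz (Nat.zero_le _) (Nat.le_add_left _ _)
    (z_succ_mem_weightPart h hz hN) _ (fun m hm j => exists_exponentFin_eq hm j) y

variable [CharZero K] {a k : K}

theorem nicholsIdeal_eq_and_isBasis_BInfty (hρ : ∀ n, rho b p q n ≠ 0) :
    nicholsIdeal (R12 1 a b p q k) = TwoSidedIdeal.span (quadraticRels b p ∪ zRels b p q) ∧
      IsBasis K fun s => proj (R12 1 a b p q k) (BInfty b p q s) := by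
  refine eq_and_isBasis_of_le (TwoSidedIdeal.span_le.2 ?_) (linearIndependent_BInfty hρ)
    (mem_span_BInfty (fun u hu => ?_) fun u hu => ?_)
  · rintro u (hu | hu)
    exacts [proj_eq_zero_iff.1 (proj_quadraticRels a b p q k hu),
      proj_eq_zero_iff.1 (proj_zRels a b p q k hu)]
  · exact mk_eq_zero_iff.2 (TwoSidedIdeal.subset_span (.inl hu))
  · exact mk_eq_zero_iff.2 (TwoSidedIdeal.subset_span (.inr hu))

theorem nicholsIdeal_eq_and_isBasis_BFin {N : ℕ} (hρ : ∀ n ≤ N, rho b p q n ≠ 0)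
    (hN : (p - b) / 2 - q - (N : K) * ((b + p) / 2) = 0) :
    nicholsIdeal (R12 1 a b p q k) = TwoSidedIdeal.span (quadraticRels b p ∪ zRels b p q ∪
        {z b p q (N + 1) + (((N : K) + 1) * ((b + p) / 2)) • (x K 0 * z b p q N)}) ∧
      IsBasis K fun s => proj (R12 1 a b p q k) (BFin b p q N s) := by
  refine eq_and_isBasis_of_le (TwoSidedIdeal.span_le.2 ?_) (linearIndependent_BFin hρ)
    (mem_span_BFin (fun u hu => ?_) (fun u hu => ?_) ?_)
  · rintro u ((hu | hu) | rfl)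
    exacts [proj_eq_zero_iff.1 (proj_quadraticRels a b p q k hu),
      proj_eq_zero_iff.1 (proj_zRels a b p q k hu), proj_eq_zero_iff.1 (proj_z_succ_add hN)]
  · exact mk_eq_zero_iff.2 (TwoSidedIdeal.subset_span (.inl (.inl hu)))
  · exact mk_eq_zero_iff.2 (TwoSidedIdeal.subset_span (.inl (.inr hu)))
  · exact mk_eq_zero_iff.2 (TwoSidedIdeal.subset_span (.inr rfl))

end Presentation

section Beta

variable {K : Type*} [Field K] [CharZero K] {b p q : K}

theorem beta_eq_zero_iff {n : ℕ} (hn : 1 ≤ n) :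
    beta b p q n = 0 ↔ (p - b) / 2 - q - (n : K) * ((b + p) / 2) = 0 := by
  have beta_eq : beta b p q n = n * ((p - b) / 2 - q - (n : K) * ((b + p) / 2)) := by
    rw [beta]
    ring
  rw [beta_eq, mul_eq_zero, or_iff_right (Nat.cast_ne_zero.2 (Nat.ne_of_gt hn))]

theorem half_sub_ne_zero (hb : b ≠ p - 2 * q) : (p - b) / 2 - q ≠ 0 := fun h =>
  hb (by linear_combination -2 * h)

theorem beta_eq_zero_unique (hb : b ≠ p - 2 * q) {m n : ℕ} (hm : 1 ≤ m) (hn : 1 ≤ n)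
    (h : beta b p q m = 0) (h' : beta b p q n = 0) : m = n := by
  rw [beta_eq_zero_iff hm] at h
  rw [beta_eq_zero_iff hn] at h'
  have step_ne_zero : (b + p) / 2 ≠ 0 := by
    intro h₀
    rw [h₀, mul_zero, sub_zero] at h
    exact half_sub_ne_zero hb h
  have cast_eq : (m : K) = n := mul_right_cancel₀ step_ne_zero (by linear_combination h' - h)
  exact_mod_cast cast_eq

theorem rho_ne_zero (hb : b ≠ p - 2 * q) {n : ℕ}
    (h : ∀ j, 1 ≤ j → j < n → beta b p q j ≠ 0) : rho b p q n ≠ 0 := by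
  refine mul_ne_zero (Nat.cast_add_one_ne_zero n) (Finset.prod_ne_zero_iff.2 fun j hj => ?_)
  obtain rfl | hpos := Nat.eq_zero_or_pos j
  · rw [Nat.cast_zero, zero_mul, sub_zero]
    exact half_sub_ne_zero hb
  · exact fun h₀ => h j hpos (Finset.mem_range.1 hj) ((beta_eq_zero_iff hpos).2 h₀)

end Beta

section GKdim

open Filter Topology

variable {K A : Type*} [Field K] [Ring A] [Algebra K A]

theorem tendsto_add_div_log (m : ℕ) (c : ℝ) :
    Tendsto (fun n : ℕ => (((m : ℝ) + c / Real.log n : ℝ) : EReal)) atTop (𝓝 (m : EReal)) := by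
  have h : Tendsto (fun n : ℕ => (m : ℝ) + c / Real.log n) atTop (𝓝 ((m : ℝ) + 0)) :=
    tendsto_const_nhds.add
      ((Real.tendsto_log_atTop.comp tendsto_natCast_atTop_atTop).const_div_atTop c)
  rw [add_zero] at h
  exact (continuous_coe_real_ereal.tendsto _).comp h

theorem fg_one_sup {V : Submodule K A} (hV : V.FG) : (1 ⊔ V).FG := by
  rw [Submodule.one_eq_span]
  exact (Submodule.fg_span_singleton 1).sup hV

theorem prod_ofFn_pow_mem {V : Submodule K A} {m : ℕ} {u : Fin m → A} (hu : ∀ i, u i ∈ V)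
    (e : Fin m → ℕ) : (List.ofFn fun i => u i ^ e i).prod ∈ V ^ ∑ i, e i := by
  induction m with
  | zero => simpa using (⟨1, map_one _⟩ : ∃ y, algebraMap K A y = 1)
  | succ m ih =>
    rw [List.ofFn_succ, List.prod_cons, Fin.sum_univ_succ, pow_add]
    exact Submodule.mul_mem_mul (Submodule.pow_mem_pow _ (hu 0) _)
      (ih (fun i => hu i.succ) fun i => e i.succ)

theorem pow_le_finrank_one_sup_span_pow {m : ℕ} {u : Fin m → A}
    (hu : LinearIndependent K fun e : Fin m → ℕ => (List.ofFn fun i => u i ^ e i).prod) (n : ℕ) :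
    (n / m + 1) ^ m ≤ Module.finrank K ↥((1 ⊔ Submodule.span K (Set.range u)) ^ n) := by
  let W := 1 ⊔ Submodule.span K (Set.range u)
  have finite : Module.Finite K ↥(W ^ n) :=
    Module.Finite.iff_fg.2 ((fg_one_sup (Submodule.fg_span (Set.finite_range u))).pow n)
  have u_mem (i : Fin m) : u i ∈ W := Submodule.mem_sup_right (Submodule.subset_span ⟨i, rfl⟩)
  have prod_mem (e : Fin m → Fin (n / m + 1)) :
      (List.ofFn fun i => u i ^ (e i : ℕ)).prod ∈ W ^ n := by
    have degree_le : ∑ i, (e i : ℕ) ≤ n := calc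
      ∑ i, (e i : ℕ) ≤ ∑ _i : Fin m, n / m := Finset.sum_le_sum fun i _ => Nat.lt_succ_iff.1 (e i).2
      _ = m * (n / m) := Fin.sum_const m (n / m)
      _ ≤ n := Nat.mul_div_le n m
    exact pow_le_pow_right' (le_sup_left : (1 : Submodule K A) ≤ W) degree_le
      (prod_ofFn_pow_mem u_mem _)
  have coe_injective : Function.Injective fun (e : Fin m → Fin (n / m + 1)) i => (e i : ℕ) :=
    Fin.val_injective.comp_left
  have indep :
      LinearIndependent K fun e : Fin m → Fin (n / m + 1) => (⟨_, prod_mem e⟩ : ↥(W ^ n)) :=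
    .of_comp (Submodule.subtype _) (hu.comp _ coe_injective)
  simpa using indep.fintype_card_le_finrank

theorem natCast_le_limsup_log {d : ℕ → ℕ} {m : ℕ} (hm : 0 < m) (hd : ∀ n, (n / m + 1) ^ m ≤ d n) :
    (m : EReal) ≤ limsup (fun n : ℕ => ((Real.log (d n) / Real.log n : ℝ) : EReal)) atTop := by
  rw [← (tendsto_add_div_log m (-(m * Real.log m))).limsup_eq]
  refine limsup_le_limsup ?_
  filter_upwards [eventually_ge_atTop 2] with n hn
  rw [EReal.coe_le_coe_iff]
  have n_pos : (0 : ℝ) < n := by positivity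
  have m_pos : (0 : ℝ) < m := Nat.cast_pos.2 hm
  have log_pos : 0 < Real.log n := Real.log_pos (Nat.one_lt_cast.2 hn)
  have pow_le : ((n : ℝ) / m) ^ m ≤ d n := calc
    ((n : ℝ) / m) ^ m ≤ ((n / m + 1 : ℕ) : ℝ) ^ m := by
      gcongr
      rw [div_le_iff₀ m_pos]
      exact_mod_cast mul_comm m _ ▸ (Nat.lt_mul_div_succ n hm).le
    _ ≤ d n := by exact_mod_cast hd n
  have log_le := Real.log_le_log (by positivity) pow_le
  rw [Real.log_pow, Real.log_div n_pos.ne' m_pos.ne'] at log_le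
  rw [le_div_iff₀ log_pos, add_mul, div_mul_cancel₀ _ log_pos.ne']
  linarith

theorem natCast_le_GKdim {m : ℕ} (hm : 0 < m) {u : Fin m → A}
    (hu : LinearIndependent K fun e : Fin m → ℕ => (List.ofFn fun i => u i ^ e i).prod) :
    (m : EReal) ≤ GKdim K A :=
  (natCast_le_limsup_log hm (pow_le_finrank_one_sup_span_pow hu)).trans
    (le_iSup (fun W : {W : Submodule K A // W.FG} => limsup (fun n : ℕ =>
      ((Real.log (Module.finrank K ↥((1 ⊔ W.1) ^ n)) / Real.log n : ℝ) : EReal)) atTop)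
      ⟨_, Submodule.fg_span (Set.finite_range u)⟩)

theorem exists_le_pow {V W : Submodule K A} (hW : W.FG) (hgen : ∀ y, ∃ n, y ∈ (1 ⊔ V) ^ n) :
    ∃ k, W ≤ (1 ⊔ V) ^ k := by
  obtain ⟨s, rfl⟩ := hW
  choose f hf using hgen
  exact ⟨s.sup f, Submodule.span_le.2 fun y hy =>
    pow_le_pow_right' (le_sup_left : (1 : Submodule K A) ≤ 1 ⊔ V) (Finset.le_sup hy) (hf y)⟩

theorem limsup_log_le_natCast {d : ℕ → ℕ} {m k : ℕ} (hd : ∀ n, d n ≤ (k * n + 1) ^ m) :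
    limsup (fun n : ℕ => ((Real.log (d n) / Real.log n : ℝ) : EReal)) atTop ≤ m := by
  rw [← (tendsto_add_div_log m (m * Real.log (k + 1))).limsup_eq]
  refine limsup_le_limsup ?_
  filter_upwards [eventually_ge_atTop 2] with n hn
  rw [EReal.coe_le_coe_iff]
  have one_le : (1 : ℝ) ≤ n := Nat.one_le_cast.2 (one_le_two.trans hn)
  have log_pos : 0 < Real.log n := Real.log_pos (Nat.one_lt_cast.2 hn)
  have log_le : Real.log (d n) ≤ Real.log (((k + 1) * n) ^ m) := by
    obtain h₀ | hpos := Nat.eq_zero_or_pos (d n)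
    · rw [h₀, Nat.cast_zero, Real.log_zero]
      exact Real.log_nonneg (one_le_pow₀ (one_le_mul_of_one_le_of_one_le (by simp) one_le))
    · refine Real.log_le_log (Nat.cast_pos.2 hpos) ?_
      calc (d n : ℝ) ≤ (k * n + 1) ^ m := by exact_mod_cast hd n
        _ ≤ ((k + 1) * n) ^ m := by gcongr; linarith
  rw [Real.log_pow, Real.log_mul (by positivity) (by positivity)] at log_le
  rw [div_le_iff₀ log_pos, add_mul, div_mul_cancel₀ _ log_pos.ne']
  linarith

theorem GKdim_le_natCast {m : ℕ} {V : Submodule K A} (hV : V.FG)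
    (hgen : ∀ y, ∃ n, y ∈ (1 ⊔ V) ^ n)
    (hdim : ∀ n, Module.finrank K ↥((1 ⊔ V) ^ n) ≤ (n + 1) ^ m) : GKdim K A ≤ m := by
  refine iSup_le fun ⟨W, hW⟩ => ?_
  obtain ⟨k, hk⟩ := exists_le_pow hW hgen
  refine limsup_log_le_natCast (k := k) fun n => ?_
  have finite : Module.Finite K ↥((1 ⊔ V) ^ (k * n)) :=
    Module.Finite.iff_fg.2 ((fg_one_sup hV).pow _)
  refine (Submodule.finrank_mono ?_).trans (hdim (k * n))
  rw [pow_mul]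
  exact pow_le_pow_left' (sup_le (one_le_pow_of_one_le' le_sup_left k) hk) n

end GKdim

section Growth

variable {K : Type*} [Field K]

theorem finrank_filtration_le {A : Type*} [Ring A] [Algebra K A] (φ : MvPolynomial ℕ K →ₐ[K] A)
    (t : A) (N n : ℕ) : Module.Finite K ↥(filtration φ zWeight {i | i ≤ N + 1} t n) ∧
      Module.finrank K ↥(filtration φ zWeight {i | i ≤ N + 1} t n) ≤ (n + 1) ^ (N + 3) := by
  let F (s : Fin (n + 1) × Fin (n + 1) × (Fin N → Fin (n + 1)) × Fin (n + 1)) : A :=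
    φ (MvPolynomial.monomial (exponent (s.1 : ℕ) s.2.1 fun j => (s.2.2.1 j : ℕ)) 1) *
      t ^ (s.2.2.2 : ℕ)
  have le : filtration φ zWeight {i | i ≤ N + 1} t n ≤ Submodule.span K (Set.range F) := by
    refine Submodule.span_mono ?_
    rintro _ ⟨m, hm, j, hj, rfl⟩
    have lt (i : ℕ) : m i < n + 1 :=
      Nat.lt_succ_of_le ((Finsupp.le_weight zWeight (zWeight_ne_zero i) m).trans
        ((Nat.le_add_right _ _).trans hj))
    refine ⟨(⟨m 0, lt 0⟩, ⟨m 1, lt 1⟩, fun i => ⟨m (i + 2), lt _⟩,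
      ⟨j, Nat.lt_succ_of_le ((Nat.le_add_left _ _).trans hj)⟩), ?_⟩
    simp only [F, exponent_eq_of_mem_supported hm]
  have finite : Module.Finite K ↥(Submodule.span K (Set.range F)) :=
    Module.Finite.span_of_finite K (Set.finite_range F)
  refine ⟨Submodule.finiteDimensional_of_le le, (Submodule.finrank_mono le).trans ?_⟩
  refine (finrank_range_le_card F).trans (le_of_eq ?_)
  simp only [Fintype.card_prod, Fintype.card_fin, Fintype.card_pi, Finset.prod_const,
    Finset.card_univ]
  ring

variable {a b p q k : K}

/-- The elements `x_1, x_2, z_1, …, z_N, x_3`. -/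
def pbwGenerators (b p q : K) (N : ℕ) : Fin (N + 1 + 1 + 1) → FreeAlgebra K (Fin 3) :=
  Fin.cons (x K 0) (Fin.cons (x K 1)
    (Fin.snoc (α := fun _ => FreeAlgebra K (Fin 3)) (fun j : Fin N => z b p q (j + 1)) (x K 2)))

/-- The exponents on `x_1, x_2, z_1, …, z_N, x_3`, in the form that indexes `BFin b p q N`. -/
def pbwExponents {N : ℕ} (e : Fin (N + 1 + 1 + 1) → ℕ) : ℕ × ℕ × (Fin N → ℕ) × ℕ :=
  (e 0, e 1, fun j => e j.castSucc.succ.succ, e (Fin.last _))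

theorem pbwExponents_injective (N : ℕ) : Function.Injective (pbwExponents (N := N)) := by
  intro e e' h
  simp only [pbwExponents, Prod.mk.injEq] at h
  obtain ⟨h₀, h₁, h₂, h₃⟩ := h
  exact funext (Fin.cases h₀ (Fin.cases h₁ (Fin.lastCases h₃ (congrFun h₂))))

theorem prod_pbwGenerators {N : ℕ} (e : Fin (N + 1 + 1 + 1) → ℕ) :
    (List.ofFn fun i => pbwGenerators b p q N i ^ e i).prod = BFin b p q N (pbwExponents e) := by
  rw [List.ofFn_succ, List.ofFn_succ, List.ofFn_succ', List.concat_eq_append, List.prod_cons,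
    List.prod_cons, List.prod_append, List.prod_singleton]
  simp only [pbwGenerators, Fin.cons_zero, Fin.cons_succ, Fin.snoc_castSucc, Fin.snoc_last, BFin,
    monomial, mul_assoc]
  rfl

variable [CharZero K]

theorem natCast_le_GKdim_nichols {N : ℕ} (hρ : ∀ n ≤ N, rho b p q n ≠ 0) :
    ((N + 3 : ℕ) : EReal) ≤ GKdim K (NicholsAlgebra (R12 1 a b p q k)) := by
  refine natCast_le_GKdim (Nat.succ_pos _)
    (u := fun i => proj (R12 1 a b p q k) (pbwGenerators b p q N i)) ?_
  have prod_eq (e : Fin (N + 1 + 1 + 1) → ℕ) :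
      (List.ofFn fun i => proj (R12 1 a b p q k) (pbwGenerators b p q N i) ^ e i).prod =
        proj (R12 1 a b p q k) (BFin b p q N (pbwExponents e)) := by
    rw [← prod_pbwGenerators, map_list_prod, List.map_ofFn]
    simp only [Function.comp_def, map_pow]
  simp only [prod_eq]
  exact (linearIndependent_BFin hρ).comp _ (pbwExponents_injective N)

theorem GKdim_nichols_eq_top (hρ : ∀ n, rho b p q n ≠ 0) :
    GKdim K (NicholsAlgebra (R12 1 a b p q k)) = ⊤ := by
  refine EReal.eq_top_iff_forall_lt _ |>.2 fun c => ?_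
  obtain ⟨N, hN⟩ := exists_nat_gt c
  refine lt_of_lt_of_le ?_ (natCast_le_GKdim_nichols (N := N) fun n _ => hρ n)
  rw [← EReal.coe_coe_eq_natCast, EReal.coe_lt_coe_iff]
  exact hN.trans_le (Nat.cast_le.2 (Nat.le_add_right N 3))

theorem GKdim_nichols_le {N : ℕ} (hN : (p - b) / 2 - q - (N : K) * ((b + p) / 2) = 0) :
    GKdim K (NicholsAlgebra (R12 1 a b p q k)) ≤ ((N + 3 : ℕ) : EReal) := by
  let π := proj (R12 1 a b p q k)
  refine GKdim_le_natCast (V := Submodule.span K (Set.range fun i => π (x K i)))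
    (Submodule.fg_span (Set.finite_range _)) (fun u => ?_) fun n => ?_
  · obtain ⟨y, rfl⟩ := proj_surjective u
    exact exists_mem_pow_span_generators π y
  · have rel : π (z b p q (N + 1) + (((N : K) + 1) * ((b + p) / 2)) • (x K 0 * z b p q N)) = 0 :=
      proj_z_succ_add hN
    have le := pow_le_filtration (s := {i | i ≤ N + 1}) (fun _ => proj_quadraticRels a b p q k)
      (fun _ => proj_zRels a b p q k) (Nat.zero_le _) (Nat.le_add_left _ _)
      (z_succ_mem_weightPart _ _ rel) n
    obtain ⟨finite, finrank_le⟩ := finrank_filtration_le (K := K) _ (π (x K 2)) N n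
    exact (Submodule.finrank_mono le).trans finrank_le

end Growth

end Nichols

end

theorem proposition3p3 {K : Type*} [Field K] [CharZero K] (t a b p q k : K)
    (ht : t = 1) (hb : b ≠ p - 2 * q) :
    ((∀ n : ℕ, 1 ≤ n → Nichols.beta b p q n ≠ 0) →
      Nichols.nicholsIdeal (Nichols.R12 t a b p q k) =
          TwoSidedIdeal.span (Nichols.quadraticRels b p ∪ Nichols.zRels b p q) ∧
        Nichols.IsBasis K
          (fun s => Nichols.proj (Nichols.R12 t a b p q k) (Nichols.BInfty b p q s)) ∧
        Nichols.GKdim K (Nichols.NicholsAlgebra (Nichols.R12 t a b p q k)) = ⊤) ∧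
    ((¬ ∀ n : ℕ, 1 ≤ n → Nichols.beta b p q n ≠ 0) →
      (∃! N : ℕ, 1 ≤ N ∧ Nichols.beta b p q N = 0) ∧
        ∀ N : ℕ, 1 ≤ N → Nichols.beta b p q N = 0 →
          Nichols.nicholsIdeal (Nichols.R12 t a b p q k) =
              TwoSidedIdeal.span (Nichols.quadraticRels b p ∪ Nichols.zRels b p q ∪
                {Nichols.z b p q (N + 1) +
                  (((N : K) + 1) * ((b + p) / 2)) • (Nichols.x K 0 * Nichols.z b p q N)}) ∧
            Nichols.IsBasis K
              (fun s => Nichols.proj (Nichols.R12 t a b p q k) (Nichols.BFin b p q N s)) ∧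
            Nichols.GKdim K (Nichols.NicholsAlgebra (Nichols.R12 t a b p q k)) =
              ((N + 3 : ℕ) : EReal)) := by
  subst ht
  refine ⟨fun hβ => ?_, fun hβ => ?_⟩
  · have hρ (n : ℕ) : Nichols.rho b p q n ≠ 0 := Nichols.rho_ne_zero hb fun j hj _ => hβ j hj
    obtain ⟨ideal_eq, isBasis⟩ := Nichols.nicholsIdeal_eq_and_isBasis_BInfty (a := a) (k := k) hρ
    exact ⟨ideal_eq, isBasis, Nichols.GKdim_nichols_eq_top hρ⟩
  · push Not at hβ
    obtain ⟨M, hM, hβM⟩ := hβ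
    refine ⟨⟨M, ⟨hM, hβM⟩, fun m hm => Nichols.beta_eq_zero_unique hb hm.1 hM hm.2 hβM⟩,
      fun N hN hβN => ?_⟩
    have hρ (n : ℕ) (hn : n ≤ N) : Nichols.rho b p q n ≠ 0 :=
      Nichols.rho_ne_zero hb fun j hj hjn hβj =>
        (hjn.trans_le hn).ne (Nichols.beta_eq_zero_unique hb hj hN hβj hβN)
    have factor_eq_zero := (Nichols.beta_eq_zero_iff hN).1 hβN
    obtain ⟨ideal_eq, isBasis⟩ :=
      Nichols.nicholsIdeal_eq_and_isBasis_BFin (a := a) (k := k) hρ factor_eq_zero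
    exact ⟨ideal_eq, isBasis, le_antisymm (Nichols.GKdim_nichols_le factor_eq_zero)
      (Nichols.natCast_le_GKdim_nichols hρ)⟩
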